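/- For real numbers $\alpha,\beta>0$ with $\alpha+\beta<1$, let $T=T_{\alpha,\beta}$ be the three-interval exchange of $[0,1)$ given by $Tx=x+1-\alpha$ on $X_1=[0,\alpha)$, $Tx=x+1-2\alpha-\beta$ on $X_2=[\alpha,\alpha+\beta)$, and $Tx=x-\alpha-\beta$ on $X_3=[\alpha+\beta,1)$. Assume the i.d.o.c. condition: for integers $p,q$, the relation $p\alpha+q\beta=p-q$ holds only for $p=q=0$, and the relations $p\alpha+q\beta=p-q+1$ and $p\alpha+q\beta=p-q-1$ never hold. Let $L=L(T)$ be the set of all finite factors of the trajectories $(x_n)_{n\ge 0}$ of points $x\in[0,1)$, where $x_n=i$ if $T^nx\in X_i$, and let $(X_L,S)$ be the one-sided shift on the set of infinite sequences all of whose finite factors lie in $L$. For a shift-invariant probability measure $\mu$ on $X_L$, let $e_n(\mu)$ be the smallest positive measure $\mu[w]$ of a cylinder given by a word $w\in L$ of length $n$; if $\mu$ is the only such measure, write $e_n=e_n(\mu)$ and $\mathcal B'=\liminf_{n\to\infty}\frac1{n e_n}\in[0,+\infty]$. Theorem. Under these assumptions $(X_L,S)$ is always minimal (that is, $L$ is uniformly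 recurrent) and uniquely ergodic, and the set of all values of $\mathcal B'$, when $(\alpha,\beta)$ ranges over all such parameters, is exactly the interval $[2,+\infty]$. The set of values is again exactly $[2,+\infty]$ if only the parameters with $\alpha<\frac12$ and $2\alpha+\beta>1$ are considered. In particular, for some parameters the minimal, uniquely ergodic system $(X_L,S)$ satisfies $n e_n\to 0$, so that Boshernitzan's sufficient condition for unique ergodicity of a minimal symbolic system (that $n e_n(\mu)\not\to 0$ for some invariant probability measure $\mu$) is not necessary, even for three-interval exchanges. -/

import Mathlib

open Filter Topology MeasureTheory
open scoped ENNReal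

noncomputable section

namespace Symbolic

variable {A : Type*}

/-- The word `x_r x_{r+1} … x_{r+n-1}` of length `n` occurring in the sequence `x` at place `r`. -/
def block (x : ℕ → A) (r n : ℕ) : List A := (List.range n).map (fun i => x (r + i))

/-- The one-sided shift. -/
def shift (x : ℕ → A) : ℕ → A := fun n => x (n + 1)

/-- The set `X_L` of infinite sequences all of whose finite factors belong to `L`. -/
def system (L : Language A) : Set (ℕ → A) := {x | ∀ r n : ℕ, block x r n ∈ L}

/-- The cylinder `[w]` in `X_L`. -/
def cylinder (L : Language A) (w : List A) : Set (ℕ → A) :=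
  {x | x ∈ system L ∧ block x 0 w.length = w}

/-- Uniform recurrence of `L`: every word `w` of `L` is a factor of all words of `L` of some
length `N`. This is minimality of the symbolic system `(X_L, S)`. -/
def IsMinimal (L : Language A) : Prop :=
  ∀ w ∈ L, ∃ N : ℕ, ∀ v ∈ L, v.length = N → w <:+: v

variable [MeasurableSpace A]

/-- `μ` is a shift-invariant probability measure on `X_L` (seen as a measure on the space of all
sequences that is carried by `X_L`). -/
def IsInvariantProbability (L : Language A) (μ : Measure (ℕ → A)) : Prop :=
  IsProbabilityMeasure μ ∧ μ (system L)ᶜ = 0 ∧ MeasurePreserving shift μ μ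

/-- `μ` is the only shift-invariant probability measure on `X_L`. -/
def IsUniqueInvariantProbability (L : Language A) (μ : Measure (ℕ → A)) : Prop :=
  IsInvariantProbability L μ ∧ ∀ ν, IsInvariantProbability L ν → ν = μ

/-- Unique ergodicity of the symbolic system `(X_L, S)`. -/
def IsUniquelyErgodic (L : Language A) : Prop :=
  ∃ μ : Measure (ℕ → A), IsUniqueInvariantProbability L μ

/-- `e_n(μ)`: the smallest positive frequency `μ[w]` of the words `w` of length `n` of `L`. -/
def minFreq (L : Language A) (μ : Measure (ℕ → A)) (n : ℕ) : ℝ≥0∞ :=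
  sInf {t | ∃ w ∈ L, w.length = n ∧ t = μ (cylinder L w) ∧ 0 < t}

/-- `𝓑' = liminf 1 / (n e_n)`, computed with the measure `μ`, with values in `[0, +∞]`. -/
def lowerB (L : Language A) (μ : Measure (ℕ → A)) : ℝ≥0∞ :=
  liminf (fun n : ℕ => 1 / ((n : ℝ≥0∞) * minFreq L μ n)) atTop

/-- The lower BL spectrum of a family of symbolic systems, given by their languages: the set of
values of `𝓑'` on the uniquely ergodic systems of the family. -/
def lowerBLSpectrum (F : Set (Language A)) : Set ℝ≥0∞ :=
  {v | ∃ L ∈ F, ∃ μ : Measure (ℕ → A), IsUniqueInvariantProbability L μ ∧ lowerB L μ = v}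

end Symbolic

namespace ThreeInterval

/-- The three-interval exchange on `[0, 1)` with discontinuities `α` and `α + β`. Only its values
on `[0, 1)`, which it maps to itself, are used. -/
def exchange (α β : ℝ) (x : ℝ) : ℝ :=
  if x < α then x + 1 - α
  else if x < α + β then x + 1 - 2 * α - β
  else x - α - β

/-- The natural partition `X_1 = [0, α)`, `X_2 = [α, α + β)`, `X_3 = [α + β, 1)`, with labels
`0, 1, 2` in place of `1, 2, 3`. -/
def label (α β : ℝ) (x : ℝ) : Fin 3 :=
  if x < α then 0 else if x < α + β then 1 else 2

/-- The trajectory of the point `x`. -/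
def trajectory (α β x : ℝ) : ℕ → Fin 3 := fun n => label α β ((exchange α β)^[n] x)

/-- The language of all finite factors of trajectories of points of `[0, 1)`. -/
def language (α β : ℝ) : Language (Fin 3) :=
  {w | ∃ x ∈ Set.Ico (0 : ℝ) 1, ∃ r n : ℕ, w = Symbolic.block (trajectory α β x) r n}

/-- Keane's i.d.o.c. condition; the relation `0 α + 0 β = 0 - 0` is of course not counted. -/
def IDOC (α β : ℝ) : Prop :=
  ∀ p q : ℤ,
    ((p * α + q * β : ℝ) = p - q → p = 0 ∧ q = 0) ∧
    (p * α + q * β : ℝ) ≠ p - q + 1 ∧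
    (p * α + q * β : ℝ) ≠ p - q - 1

/-- The admissible parameters of three-interval exchanges. -/
def IsParameter (α β : ℝ) : Prop := 0 < α ∧ 0 < β ∧ α + β < 1 ∧ IDOC α β

/-- The family of (natural codings of) three-interval exchanges satisfying i.d.o.c. -/
def family : Set (Language (Fin 3)) :=
  {L | ∃ α β : ℝ, IsParameter α β ∧ L = language α β}

/-- The subfamily given by the additional conditions `α < 1/2` and `2α + β > 1`. -/
def restrictedFamily : Set (Language (Fin 3)) :=
  {L | ∃ α β : ℝ, IsParameter α β ∧ α < 1 / 2 ∧ 1 < 2 * α + β ∧ L = language α β}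

end ThreeInterval

end

/-! Put M = 1 + β and θ = (1 - α)/M. The exchange T is the first return map to [0, 1) of the
rotation by 1 - α on the circle of length M, and i.d.o.c. makes θ irrational. Orbits of the rotation
are equidistributed uniformly in the starting point and in the interval, and this passes to T
(`exists_equidistribution`). The points whose trajectory begins with a given word form an interval,
so every word has a uniform frequency, the length of its interval. This gives minimality and unique
ergodicity (`isMinimal_language`, `measure_block_eq`), and e_n is the length of the shortest
interval of level n.

The bound 𝓑' ≥ 2 comes from counting: by i.d.o.c. the preimages of the two discontinuities under
T^i, i < n, are 2n distinct points with distinct words of length n, so 2 n e_n ≤ 1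
(`two_mul_minFreq_le`).

For the other inclusion, n steps of T take Mn + o(n) steps of the rotation, and the intervals of
level n have endpoints on the backward orbits of 0 and 1 of that length. Up to o(n) in the range of
j, e_n is therefore governed by the distances from 0 of jθ and y + jθ modulo 1, times M, for |j| ≤
Mn, where y = 1/M (`exists_minFreq_le`, `exists_le_minFreq`).

Given t in [0, 1/2], one builds θ with denominators q_k and errors δ_k = q_k θ - p_k such that
q_{k+1} δ_k → 1 and q_k δ_k → 0, and a point y at distance ρ_k above m_k θ modulo 1, with m_k ≤ t
q_{k+1} + 7 q_k and q_{k+1} ρ_k → t. For Mn between q_k and q_{k+1}, the bound e_n ≤ M δ_k serves as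
long as Mn < m_k, and e_n ≤ M ρ_k afterwards. Both give n e_n ≤ t + o(1). Just before Mn = q_{k+1},
all distances are at least about M min(t, 1 - t)/q_{k+1}, so n e_n is at least about t. Hence limsup
n e_n = t and 𝓑' = 1/t (`limsup_mul_minFreq`, `lowerB_param`); t = 0 is the counterexample to
necessity. -/

namespace Rotation

/-! ### Uniform equidistribution of irrational rotations -/

/-- The number of visits to `[a, b)` modulo `1` of the first `N` points of the orbit of `z` under
the rotation by `ϑ`. -/
noncomputable def visits (ϑ z a b : ℝ) (N : ℕ) : ℕ :=
  ((Finset.range N).filter (fun j : ℕ => Int.fract (z + j * ϑ) ∈ Set.Ico a b)).card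

theorem visits_le (ϑ z a b : ℝ) (N : ℕ) : visits ϑ z a b N ≤ N :=
  (Finset.card_filter_le _ _).trans (by simp)

theorem visits_add (ϑ z a b : ℝ) (N K : ℕ) :
    visits ϑ z a b (N + K) = visits ϑ z a b N + visits ϑ (z + N * ϑ) a b K := by
  unfold visits
  simp only [Finset.card_filter, Finset.sum_range_add]
  congr 1
  refine Finset.sum_congr rfl fun j _ => ?_
  have : z + ((N + j : ℕ) : ℝ) * ϑ = z + N * ϑ + j * ϑ := by push_cast; ring
  rw [this]

theorem visits_one (ϑ z a b : ℝ) :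
    visits ϑ z a b 1 = if Int.fract z ∈ Set.Ico a b then 1 else 0 := by
  rw [visits, Finset.card_filter, Finset.sum_range_one]
  simp

theorem visits_split (ϑ z : ℝ) {a b : ℝ} (hab : a ≤ b) (N : ℕ) :
    visits ϑ z 0 a N + visits ϑ z a b N + visits ϑ z b 1 N = N := by
  unfold visits
  simp only [Finset.card_filter, ← Finset.sum_add_distrib]
  rw [Finset.sum_congr rfl (g := fun _ => 1)]
  · simp
  intro j _
  have h0 := Int.fract_nonneg (z + j * ϑ)
  have h1 := Int.fract_lt_one (z + j * ϑ)
  simp only [Set.mem_Ico]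
  rcases lt_or_ge (Int.fract (z + j * ϑ)) a with h | h
  · rw [if_pos ⟨h0, h⟩, if_neg (by intro h'; linarith [h'.1]), if_neg (by intro h'; linarith [h'.1])]
  · rcases lt_or_ge (Int.fract (z + j * ϑ)) b with h' | h'
    · rw [if_neg (by intro h'; linarith [h'.2]), if_pos ⟨h, h'⟩,
        if_neg (by intro h'; linarith [h'.1])]
    · rw [if_neg (by intro h'; linarith [h'.2]), if_neg (by intro h'; linarith [h'.2]),
        if_pos ⟨h', h1⟩]

theorem card_Icc_floor_ceil_le {u v : ℝ} (h : u ≤ v) :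
    ((Finset.Icc ⌊u⌋ ⌈v⌉).card : ℝ) ≤ v - u + 3 := by
  have h1 : ⌊u⌋ ≤ ⌈v⌉ + 1 := by
    have : (⌊u⌋ : ℝ) ≤ ⌈v⌉ := (Int.floor_le u).trans (h.trans (Int.le_ceil v))
    have : ⌊u⌋ ≤ ⌈v⌉ := by exact_mod_cast this
    omega
  rw [Int.card_Icc, ← Int.cast_natCast, Int.toNat_of_nonneg (by omega)]
  push_cast
  linarith [Int.lt_floor_add_one u, Int.ceil_lt_add_one v]

/-- Over one period of the approximating rational the points are nearly equally spaced, so visits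
can be counted by integers in an interval. -/
theorem visits_den_le {ϑ : ℝ} {r : ℚ} (hr : |ϑ - r| < 1 / (r.den : ℝ) ^ 2) (z : ℝ) {a b : ℝ}
    (hab : a ≤ b) : (visits ϑ z a b r.den : ℝ) ≤ r.den * (b - a) + 5 := by
  set q := r.den with hq
  have hq0 : (0 : ℝ) < q := by exact_mod_cast r.den_pos
  have hrq : (r : ℝ) * q = r.num := by
    have := Rat.mul_den_eq_num r
    exact_mod_cast this
  -- This integer differs from `q * (fract (z + j * ϑ) - z)` by at most 1. It is congruent to `j *
  -- r.num` modulo `q`, whence injectivity on the first `q` indices.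
  let f : ℕ → ℤ := fun j => j * r.num - q * ⌊z + j * ϑ⌋
  have hmaps : ∀ j ∈ (Finset.range q).filter (fun j : ℕ => Int.fract (z + j * ϑ) ∈ Set.Ico a b),
      f j ∈ Finset.Icc ⌊q * (a - z) - 1⌋ ⌈q * (b - z) + 1⌉ := by
    intro j hj
    rw [Finset.mem_filter, Finset.mem_range, Set.mem_Ico] at hj
    obtain ⟨hj, hja, hjb⟩ := hj
    have hjq : (j : ℝ) < q := by exact_mod_cast hj
    have hj0 : (0 : ℝ) ≤ j := by positivity
    have herr : |(j : ℝ) * q * (ϑ - r)| ≤ 1 := by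
      rw [abs_mul, abs_of_nonneg (by positivity)]
      calc (j : ℝ) * q * |ϑ - r| ≤ q * q * (1 / (q : ℝ) ^ 2) := by gcongr
        _ = 1 := by field_simp
    have hf : (f j : ℝ) = q * (Int.fract (z + j * ϑ) - z) - j * q * (ϑ - r) := by
      simp only [f, Int.fract]
      push_cast
      rw [← hrq]
      ring
    rw [abs_le] at herr
    rw [Finset.mem_Icc]
    constructor
    · have h : ((⌊q * (a - z) - 1⌋ : ℤ) : ℝ) ≤ f j := by
        refine (Int.floor_le _).trans ?_
        rw [hf]
        nlinarith
      exact_mod_cast h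
    · have h : (f j : ℝ) ≤ ((⌈q * (b - z) + 1⌉ : ℤ) : ℝ) := by
        refine le_trans ?_ (Int.le_ceil _)
        rw [hf]
        nlinarith
      exact_mod_cast h
  have hinj : Set.InjOn f
      ((Finset.range q).filter (fun j : ℕ => Int.fract (z + j * ϑ) ∈ Set.Ico a b)) := by
    intro i hi j hj hij
    simp only [Finset.coe_filter, Finset.mem_range, Set.mem_ofPred_eq] at hi hj
    have h1 : (q : ℤ) ∣ ((i : ℤ) - j) * r.num := by
      refine ⟨⌊z + i * ϑ⌋ - ⌊z + j * ϑ⌋, ?_⟩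
      simp only [f] at hij
      linarith
    have hcop : IsCoprime (q : ℤ) r.num := by
      rw [Int.isCoprime_iff_nat_coprime]
      simpa using r.reduced.symm
    have h2 := hcop.dvd_of_dvd_mul_right h1
    have h3 := Int.eq_zero_of_abs_lt_dvd h2 (by rw [abs_lt]; omega)
    omega
  have hcard := Finset.card_le_card_of_injOn f hmaps hinj
  have hcard' : (visits ϑ z a b q : ℝ) ≤
      ((Finset.Icc ⌊q * (a - z) - 1⌋ ⌈q * (b - z) + 1⌉).card : ℝ) := by
    exact_mod_cast hcard
  refine hcard'.trans ((card_Icc_floor_ceil_le (by nlinarith)).trans (le_of_eq (by ring)))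

/-- The lower bound follows from the upper bounds for the two complementary intervals. -/
theorem abs_visits_den_sub_le {ϑ : ℝ} {r : ℚ} (hr : |ϑ - r| < 1 / (r.den : ℝ) ^ 2) (z : ℝ)
    {a b : ℝ} (ha : 0 ≤ a) (hab : a ≤ b) (hb : b ≤ 1) :
    |(visits ϑ z a b r.den : ℝ) - r.den * (b - a)| ≤ 10 := by
  have h1 := visits_den_le hr z ha
  have h2 := visits_den_le hr z hab
  have h3 := visits_den_le hr z hb
  have h : (visits ϑ z 0 a r.den : ℝ) + visits ϑ z a b r.den + visits ϑ z b 1 r.den = r.den := by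
    exact_mod_cast visits_split ϑ z hab r.den
  rw [abs_le]
  constructor <;> linarith

theorem abs_visits_mul_sub_le {ϑ : ℝ} {r : ℚ} (hr : |ϑ - r| < 1 / (r.den : ℝ) ^ 2)
    {a b : ℝ} (ha : 0 ≤ a) (hab : a ≤ b) (hb : b ≤ 1) (Q : ℕ) (z : ℝ) :
    |(visits ϑ z a b (r.den * Q) : ℝ) - (r.den * Q : ℕ) * (b - a)| ≤ 10 * Q := by
  induction Q with
  | zero => simp [visits]
  | succ Q ih =>
    have h := abs_visits_den_sub_le hr (z + (r.den * Q : ℕ) * ϑ) ha hab hb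
    rw [Nat.mul_succ, visits_add]
    rw [abs_le] at ih h ⊢
    push_cast at ih h ⊢
    constructor <;> linarith

/-- Orbits of an irrational rotation are equidistributed, uniformly in the starting point and in
the interval. -/
theorem exists_abs_visits_sub_le {ϑ : ℝ} (hϑ : Irrational ϑ) {ε : ℝ} (hε : 0 < ε) :
    ∃ C : ℝ, 0 ≤ C ∧ ∀ (N : ℕ) (z a b : ℝ), 0 ≤ a → a ≤ b → b ≤ 1 →
      |(visits ϑ z a b N : ℝ) - N * (b - a)| ≤ ε * N + C := by
  obtain ⟨r, hr, hrε⟩ : ∃ r : ℚ, |ϑ - r| < 1 / (r.den : ℝ) ^ 2 ∧ 10 / ε < r.den := by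
    -- Rationals this close to `ϑ` with bounded denominators have bounded numerators, so there would
    -- be finitely many of them.
    by_contra! hcon
    refine Real.infinite_rat_abs_sub_lt_one_div_den_sq_of_irrational hϑ ?_
    set K : ℝ := (|ϑ| + 1) * (10 / ε)
    refine Set.Finite.of_finite_image (f := fun r : ℚ => (r.num, (r.den : ℤ)))
      (((Set.finite_Icc (-⌈K⌉) ⌈K⌉).prod (Set.finite_Icc 0 ⌈10 / ε⌉)).subset ?_) ?_
    · rintro _ ⟨r, hr, rfl⟩
      have hden := hcon r hr
      have h1 : (1 : ℝ) ≤ r.den := by exact_mod_cast r.den_pos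
      have hr1 : |ϑ - r| < 1 := lt_of_lt_of_le hr (by
        rw [div_le_one (by positivity)]
        nlinarith)
      have hnum : |(r.num : ℝ)| ≤ K := by
        have h2 : (r.num : ℝ) = r * r.den := by
          have := Rat.mul_den_eq_num r
          exact_mod_cast this.symm
        rw [h2, abs_mul, Nat.abs_cast]
        have h3 : |(r : ℝ)| ≤ |ϑ| + 1 := by
          rw [abs_lt] at hr1
          rw [abs_le]
          constructor <;> linarith [neg_abs_le ϑ, le_abs_self ϑ]
        exact mul_le_mul h3 hden (by positivity) (by positivity)
      rw [abs_le] at hnum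
      refine ⟨⟨?_, ?_⟩, by positivity, ?_⟩
      · have : (-(⌈K⌉ : ℤ) : ℝ) ≤ r.num := by linarith [Int.le_ceil K]
        exact_mod_cast this
      · exact_mod_cast hnum.2.trans (Int.le_ceil K)
      · have : ((r.den : ℤ) : ℝ) ≤ ⌈10 / ε⌉ := by
          simpa using hden.trans (Int.le_ceil (10 / ε))
        exact_mod_cast this
    · intro r _ r' _ h
      simp only [Prod.mk.injEq, Nat.cast_inj] at h
      exact Rat.ext h.1 h.2
  have hq0 : (0 : ℝ) < r.den := by exact_mod_cast r.den_pos
  -- The constant absorbs the last incomplete period, of length `N % r.den`; each complete one costs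
  -- 10, which is less than `ε * r.den`.
  refine ⟨r.den, hq0.le, fun N z a b ha hab hb => ?_⟩
  have hN : (visits ϑ z a b N : ℝ) = visits ϑ z a b (r.den * (N / r.den)) +
      visits ϑ (z + (r.den * (N / r.den) : ℕ) * ϑ) a b (N % r.den) := by
    rw [← Nat.cast_add, ← visits_add, Nat.div_add_mod]
  have hN' : (N : ℝ) = (r.den * (N / r.den) : ℕ) + (N % r.den : ℕ) := by
    rw [← Nat.cast_add, Nat.div_add_mod]
  have h1 := abs_visits_mul_sub_le hr ha hab hb (N / r.den) z
  have h2 : (visits ϑ (z + (r.den * (N / r.den) : ℕ) * ϑ) a b (N % r.den) : ℝ) ≤ (N % r.den : ℕ) := by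
    exact_mod_cast visits_le _ _ _ _ _
  have h3 : ((N % r.den : ℕ) : ℝ) ≤ r.den := by exact_mod_cast (Nat.mod_lt _ r.den_pos).le
  have h4 : 10 * ((N / r.den : ℕ) : ℝ) ≤ ε * N := by
    have h5 : ((N / r.den : ℕ) : ℝ) ≤ N / r.den := Nat.cast_div_le
    rw [div_lt_iff₀ hε] at hrε
    calc 10 * ((N / r.den : ℕ) : ℝ) ≤ 10 * (N / r.den) := by gcongr
      _ ≤ (r.den * ε) * (N / r.den) := by gcongr
      _ = ε * N := by field_simp
  have h6 : (0 : ℝ) ≤ visits ϑ (z + (r.den * (N / r.den) : ℕ) * ϑ) a b (N % r.den) := by positivity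
  have h7 : ((N % r.den : ℕ) : ℝ) * (b - a) ≤ (N % r.den : ℕ) :=
    mul_le_of_le_one_right (by positivity) (by linarith)
  have h8 : 0 ≤ ((N % r.den : ℕ) : ℝ) * (b - a) := mul_nonneg (by positivity) (by linarith)
  have h9 : (N : ℝ) * (b - a) = (r.den * (N / r.den) : ℕ) * (b - a) + (N % r.den : ℕ) * (b - a) := by
    rw [← add_mul, ← hN']
  rw [hN, h9]
  rw [abs_le] at h1 ⊢
  constructor <;> linarith

end Rotation

/-! ### The exchange as a first return map of a rotation -/

namespace ThreeInterval

variable {α β : ℝ}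

theorem label_eq_zero_iff {x : ℝ} : label α β x = 0 ↔ x < α := by
  unfold label
  split_ifs <;> simp_all

theorem label_eq_one_iff {x : ℝ} : label α β x = 1 ↔ α ≤ x ∧ x < α + β := by
  unfold label
  split_ifs <;> simp_all

theorem label_eq_two_iff (hβ : 0 < β) {x : ℝ} : label α β x = 2 ↔ α + β ≤ x := by
  unfold label
  split_ifs with h1 h2
  · simp only [Fin.isValue, Fin.reduceEq, false_iff, not_le]; linarith
  · simp only [Fin.isValue, Fin.reduceEq, false_iff, not_le]; linarith
  · simp only [true_iff]; linarith

/-- The first return time to `[0, 1)` under the rotation by `1 - α` modulo `1 + β`, as a function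
of the label. -/
def weight (c : Fin 3) : ℕ := if c = 1 then 2 else 1

theorem one_le_weight (c : Fin 3) : 1 ≤ weight c := by
  unfold weight; split_ifs <;> simp

theorem weight_le_two (c : Fin 3) : weight c ≤ 2 := by
  unfold weight; split_ifs <;> simp

/-- The translation by which the exchange acts on the interval of label `c`. -/
noncomputable def translation (α β : ℝ) (c : Fin 3) : ℝ :=
  if c = 0 then 1 - α else if c = 1 then 1 - 2 * α - β else -α - β

theorem exchange_eq (α β x : ℝ) : exchange α β x = x + translation α β (label α β x) := by
  unfold exchange translation label
  split_ifs <;> first | (exfalso; simp_all; done) | ring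

theorem exists_translation_eq (α β : ℝ) (c : Fin 3) :
    ∃ l : ℤ, translation α β c = weight c * (1 - α) - l * (1 + β) := by
  fin_cases c
  · exact ⟨0, by simp [translation, weight]⟩
  · exact ⟨1, by simp [translation, weight]; ring⟩
  · exact ⟨1, by simp [translation, weight]; ring⟩

theorem exchange_mem (h : IsParameter α β) {x : ℝ} (hx : x ∈ Set.Ico (0 : ℝ) 1) :
    exchange α β x ∈ Set.Ico (0 : ℝ) 1 := by
  obtain ⟨hα, hβ, hs, -⟩ := h
  obtain ⟨h0, h1⟩ := hx
  unfold exchange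
  split_ifs <;> constructor <;> linarith

theorem iterate_mem (h : IsParameter α β) {x : ℝ} (hx : x ∈ Set.Ico (0 : ℝ) 1) (n : ℕ) :
    (exchange α β)^[n] x ∈ Set.Ico (0 : ℝ) 1 := by
  induction n with
  | zero => exact hx
  | succ n ih => rw [Function.iterate_succ_apply']; exact exchange_mem h ih

/-- The number of steps of the rotation that make up `n` steps of the exchange at `x`. -/
noncomputable def time (α β x : ℝ) (n : ℕ) : ℕ :=
  ∑ i ∈ Finset.range n, weight (label α β ((exchange α β)^[i] x))

theorem time_succ (x : ℝ) (n : ℕ) :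
    time α β x (n + 1) = time α β x n + weight (label α β ((exchange α β)^[n] x)) :=
  Finset.sum_range_succ _ _

theorem time_le (x : ℝ) (n : ℕ) : time α β x n ≤ 2 * n := by
  refine (Finset.sum_le_card_nsmul _ _ 2 fun i _ => weight_le_two _).trans ?_
  simp [mul_comm]

theorem exists_iterate_eq (α β x : ℝ) (n : ℕ) :
    ∃ l : ℤ, (exchange α β)^[n] x = x + time α β x n * (1 - α) - l * (1 + β) := by
  induction n with
  | zero => exact ⟨0, by simp [time]⟩
  | succ n ih =>
    obtain ⟨l, hl⟩ := ih
    obtain ⟨l', hl'⟩ := exists_translation_eq α β (label α β ((exchange α β)^[n] x))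
    refine ⟨l + l', ?_⟩
    rw [Function.iterate_succ_apply', exchange_eq, hl', time_succ]
    nth_rewrite 1 [hl]
    push_cast
    ring

theorem fract_div_eq {M u z : ℝ} (hu : 0 ≤ u) (huM : u < M) {l : ℤ} (h : z = u + l * M) :
    Int.fract (z / M) = u / M := by
  have hM : 0 < M := hu.trans_lt huM
  rw [Int.fract_eq_iff]
  refine ⟨by positivity, (div_lt_one hM).2 huM, l, ?_⟩
  rw [h]
  field_simp
  ring

/-- The number of visits to `[a, b)` of the first `n` points of the orbit of `x` under the
exchange. -/
noncomputable def visitCount (α β x a b : ℝ) (n : ℕ) : ℕ :=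
  ((Finset.range n).filter (fun i => (exchange α β)^[i] x ∈ Set.Ico a b)).card

/-- The rotation leaves `[0, 1)` only at the intermediate step of a point of label 1, which lands in
`[1, 1 + β)` and is not counted because `b ≤ 1`. -/
theorem visits_time (h : IsParameter α β) {x : ℝ} (hx : x ∈ Set.Ico (0 : ℝ) 1) {a b : ℝ}
    (hb : b ≤ 1) (n : ℕ) :
    Rotation.visits ((1 - α) / (1 + β)) (x / (1 + β)) (a / (1 + β)) (b / (1 + β))
      (time α β x n) = visitCount α β x a b n := by
  have hα := h.1
  have hβ := h.2.1
  have hs := h.2.2.1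
  have hM : 0 < 1 + β := by linarith
  have hmem : ∀ u : ℝ, u / (1 + β) ∈ Set.Ico (a / (1 + β)) (b / (1 + β)) ↔ u ∈ Set.Ico a b := by
    intro u
    rw [Set.mem_Ico, Set.mem_Ico, div_le_div_iff_of_pos_right hM, div_lt_div_iff_of_pos_right hM]
  induction n with
  | zero => simp [time, Rotation.visits, visitCount]
  | succ n ih =>
    obtain ⟨l, hl⟩ := exists_iterate_eq α β x n
    set y := (exchange α β)^[n] x with hy
    have hy01 : y ∈ Set.Ico (0 : ℝ) 1 := iterate_mem h hx n
    have hz : x / (1 + β) + time α β x n * ((1 - α) / (1 + β)) =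
        (x + time α β x n * (1 - α)) / (1 + β) := by ring
    have hfr : Int.fract (x / (1 + β) + time α β x n * ((1 - α) / (1 + β))) = y / (1 + β) := by
      rw [hz]
      exact fract_div_eq hy01.1 (by linarith [hy01.2]) (l := l) (by linarith)
    have hR : visitCount α β x a b (n + 1) =
        visitCount α β x a b n + if y ∈ Set.Ico a b then 1 else 0 := by
      simp only [visitCount, Finset.card_filter, Finset.sum_range_succ, hy]
    rw [time_succ, Rotation.visits_add, ih, hR]
    congr 1
    by_cases hlab : label α β y = 1
    · obtain ⟨h1, h2⟩ := label_eq_one_iff.1 hlab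
      have hfr' : Int.fract (x / (1 + β) + time α β x n * ((1 - α) / (1 + β)) +
          (1 : ℕ) * ((1 - α) / (1 + β))) = (y + (1 - α)) / (1 + β) := by
        have : x / (1 + β) + time α β x n * ((1 - α) / (1 + β)) + (1 : ℕ) * ((1 - α) / (1 + β)) =
          (x + time α β x n * (1 - α) + (1 - α)) / (1 + β) := by push_cast; ring
        rw [this]
        exact fract_div_eq (by linarith) (by linarith) (l := l) (by linarith)
      rw [← hy, hlab, show weight 1 = 1 + 1 from rfl, Rotation.visits_add, Rotation.visits_one,
        Rotation.visits_one, hfr, hfr']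
      simp only [hmem]
      rw [if_neg (c := y + (1 - α) ∈ Set.Ico a b), add_zero]
      rintro ⟨-, h4⟩
      linarith
    · rw [← hy, weight, if_neg hlab, Rotation.visits_one, hfr]
      simp only [hmem]

theorem irrational_rotation (h : IsParameter α β) : Irrational ((1 - α) / (1 + β)) := by
  have hβ := h.2.1
  rintro ⟨r, hr⟩
  have h1 := (h.2.2.2 r.den r.num).1 ?_
  · have := r.den_pos
    omega
  · have h2 : (r.num : ℝ) = r * r.den := by
      have := Rat.mul_den_eq_num r
      exact_mod_cast this.symm
    rw [eq_div_iff (by linarith)] at hr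
    rw [h2]
    push_cast
    linear_combination (r.den : ℝ) * hr

/-- The orbits of the exchange are equidistributed, uniformly in the starting point and in the
interval, and the same holds for the time spent by the rotation. -/
theorem exists_equidistribution (h : IsParameter α β) {ε : ℝ} (hε : 0 < ε) :
    ∃ C : ℝ, 0 ≤ C ∧ ∀ x ∈ Set.Ico (0 : ℝ) 1, ∀ n : ℕ,
      |(time α β x n : ℝ) - (1 + β) * n| ≤ ε * n + C ∧
      ∀ a b : ℝ, 0 ≤ a → a ≤ b → b ≤ 1 →
        |(visitCount α β x a b n : ℝ) - n * (b - a)| ≤ ε * n + C := by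
  obtain ⟨C, hC, hvis⟩ := Rotation.exists_abs_visits_sub_le (irrational_rotation h)
    (show (0 : ℝ) < ε / 8 by positivity)
  refine ⟨4 * C, by positivity, fun x hx n => ?_⟩
  have hβ := h.2.1
  have hs := h.2.2.1
  have hα := h.1
  have hM : 0 < 1 + β := by linarith
  have hτ : (time α β x n : ℝ) ≤ 2 * n := by exact_mod_cast time_le x n
  have key : ∀ a b : ℝ, 0 ≤ a → a ≤ b → b ≤ 1 →
      |(visitCount α β x a b n : ℝ) - time α β x n / (1 + β) * (b - a)| ≤ ε / 4 * n + C := by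
    intro a b ha hab hb
    have h1 := hvis (time α β x n) (x / (1 + β)) (a / (1 + β)) (b / (1 + β)) (by positivity)
      (by gcongr) (by rw [div_le_one hM]; linarith)
    rw [visits_time h hx hb] at h1
    have h2 : (time α β x n : ℝ) * (b / (1 + β) - a / (1 + β)) =
      time α β x n / (1 + β) * (b - a) := by ring
    rw [h2] at h1
    refine h1.trans ?_
    nlinarith
  -- For the whole interval the count is exactly `n`, so `key` compares `n` with `time / (1 + β)`.
  -- This estimates the time, and then replaces it in the other counts.
  have hall : visitCount α β x 0 1 n = n := by
    unfold visitCount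
    rw [Finset.filter_true_of_mem fun i _ => iterate_mem h hx i, Finset.card_range]
  have h01 := key 0 1 le_rfl zero_le_one le_rfl
  rw [hall, sub_zero, mul_one] at h01
  have hn : (0 : ℝ) ≤ ε * n := by positivity
  refine ⟨?_, fun a b ha hab hb => ?_⟩
  · have h3 : (time α β x n : ℝ) - (1 + β) * n =
        -((1 + β) * (n - time α β x n / (1 + β))) := by field_simp; ring
    rw [h3, abs_neg, abs_mul, abs_of_pos hM]
    calc (1 + β) * |(n : ℝ) - time α β x n / (1 + β)| ≤ 2 * (ε / 4 * n + C) := by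
          gcongr
          linarith
      _ ≤ ε * n + 4 * C := by linarith
  · have h4 := key a b ha hab hb
    have h5 : |(n - time α β x n / (1 + β)) * (b - a)| ≤ ε / 4 * n + C := by
      rw [abs_mul]
      refine (mul_le_of_le_one_right (abs_nonneg _) ?_).trans h01
      rw [abs_of_nonneg (by linarith)]
      linarith
    rw [abs_le] at h4 h5 ⊢
    constructor <;> nlinarith

end ThreeInterval

/-! ### Blocks of sequences -/

namespace Symbolic

variable {A : Type*}

theorem length_block (x : ℕ → A) (r n : ℕ) : (block x r n).length = n := by simp [block]

theorem block_zero (x : ℕ → A) (r : ℕ) : block x r 0 = [] := rfl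

theorem block_succ (x : ℕ → A) (r n : ℕ) :
    block x r (n + 1) = block x r n ++ [x (r + n)] := by
  simp [block, List.range_succ]

theorem block_succ' (x : ℕ → A) (n : ℕ) :
    block x 0 (n + 1) = x 0 :: block (shift x) 0 n := by
  simp [block, List.range_succ_eq_map, shift, Function.comp_def]

theorem block_iterate_shift (x : ℕ → A) (i r n : ℕ) :
    block (shift^[i] x) r n = block x (r + i) n := by
  have h : ∀ k, shift^[i] x k = x (k + i) := by
    induction i generalizing x with
    | zero => simp
    | succ i ih => intro k; rw [Function.iterate_succ_apply, ih]; simp only [shift]; congr 1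
  simp only [block, h]
  exact List.map_congr_left fun k _ => by congr 1; omega

theorem block_eq_iff {x y : ℕ → A} {r s n : ℕ} :
    block x r n = block y s n ↔ ∀ i < n, x (r + i) = y (s + i) := by
  simp [block]

theorem take_block (x : ℕ → A) (r : ℕ) {n m : ℕ} (h : m ≤ n) :
    (block x r n).take m = block x r m := by
  simp [block, ← List.map_take, List.take_range, min_eq_left h]

end Symbolic

/-! ### The intervals of points sharing a word, and their endpoints -/

namespace ThreeInterval

open Symbolic

variable {α β : ℝ}

theorem shift_trajectory (x : ℝ) :
    shift (trajectory α β x) = trajectory α β (exchange α β x) := by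
  funext n
  simp [shift, trajectory, Function.iterate_succ_apply]

theorem block_trajectory (x : ℝ) (r n : ℕ) :
    block (trajectory α β x) r n = block (trajectory α β ((exchange α β)^[r] x)) 0 n := by
  rw [block_eq_iff]
  intro i _
  simp only [trajectory, ← Function.iterate_add_apply, zero_add, add_comm i r]

/-- The set of points of `[0, 1)` whose trajectory begins with `w`. -/
def wordSet (α β : ℝ) (w : List (Fin 3)) : Set ℝ :=
  {x | x ∈ Set.Ico (0 : ℝ) 1 ∧ block (trajectory α β x) 0 w.length = w}

theorem mem_wordSet_block {x : ℝ} (hx : x ∈ Set.Ico (0 : ℝ) 1) (n : ℕ) :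
    x ∈ wordSet α β (block (trajectory α β x) 0 n) :=
  ⟨hx, by rw [length_block]⟩

theorem mem_language_iff (h : IsParameter α β) {w : List (Fin 3)} :
    w ∈ language α β ↔ (wordSet α β w).Nonempty := by
  constructor
  · rintro ⟨x, hx, r, n, rfl⟩
    rw [block_trajectory]
    exact ⟨_, mem_wordSet_block (iterate_mem h hx r) n⟩
  · rintro ⟨x, hx, hw⟩
    exact ⟨x, hx, 0, w.length, hw.symm⟩

theorem wordSet_nil : wordSet α β [] = Set.Ico 0 1 := by
  ext x; simp [wordSet, block]

theorem mem_wordSet_cons (h : IsParameter α β) {c : Fin 3} {w : List (Fin 3)} {x : ℝ} :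
    x ∈ wordSet α β (c :: w) ↔
      x ∈ Set.Ico (0 : ℝ) 1 ∧ label α β x = c ∧ exchange α β x ∈ wordSet α β w := by
  simp only [wordSet, List.length_cons, block_succ', shift_trajectory, Set.mem_ofPred_eq,
    List.cons.injEq]
  constructor
  · rintro ⟨hx, hc, hw⟩
    exact ⟨hx, hc, exchange_mem h hx, hw⟩
  · rintro ⟨hx, hc, -, hw⟩
    exact ⟨hx, hc, hw⟩

/-- The left endpoint of the interval of label `c`. -/
noncomputable def leftEnd (α β : ℝ) (c : Fin 3) : ℝ :=
  if c = 0 then 0 else if c = 1 then α else α + β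

/-- The right endpoint of the interval of label `c`. -/
noncomputable def rightEnd (α β : ℝ) (c : Fin 3) : ℝ :=
  if c = 0 then α else if c = 1 then α + β else 1

theorem label_eq_iff (h : IsParameter α β) {x : ℝ} {c : Fin 3} :
    x ∈ Set.Ico (0 : ℝ) 1 ∧ label α β x = c ↔
      x ∈ Set.Ico (leftEnd α β c) (rightEnd α β c) := by
  obtain ⟨hα, hβ, hs, -⟩ := h
  fin_cases c
  · have := @label_eq_zero_iff α β x
    simp only [Fin.zero_eta, Fin.isValue, this, leftEnd, rightEnd, Set.mem_Ico, if_true]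
    constructor
    · rintro ⟨⟨_, _⟩, _⟩; constructor <;> linarith
    · rintro ⟨_, _⟩; refine ⟨⟨?_, ?_⟩, ?_⟩ <;> linarith
  · have := @label_eq_one_iff α β x
    simp only [Fin.mk_one, Fin.isValue, this, leftEnd, rightEnd, Set.mem_Ico, if_true,
      one_ne_zero, if_false]
    constructor
    · rintro ⟨⟨_, _⟩, _⟩; assumption
    · rintro ⟨_, _⟩; refine ⟨⟨?_, ?_⟩, ?_, ?_⟩ <;> linarith
  · have := @label_eq_two_iff α β hβ x
    simp only [Fin.reduceFinMk, Fin.isValue, this, leftEnd, rightEnd, Set.mem_Ico,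
      Fin.reduceEq, if_false]
    constructor
    · rintro ⟨⟨_, _⟩, _⟩; constructor <;> linarith
    · rintro ⟨_, _⟩; refine ⟨⟨?_, ?_⟩, ?_⟩ <;> linarith

/-- The points `0` and `1` and their first `N` preimages under the rotation. -/
def IsEndpoint (α β : ℝ) (N : ℕ) (x : ℝ) : Prop :=
  ∃ j ≤ N, ∃ e l : ℤ, (e = 0 ∨ e = 1) ∧ x = e - j * (1 - α) + l * (1 + β)

theorem isEndpoint_leftEnd (c : Fin 3) : IsEndpoint α β (weight c) (leftEnd α β c) := by
  fin_cases c
  · exact ⟨0, by simp, 0, 0, by simp, by simp [leftEnd]⟩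
  · exact ⟨1, by simp [weight], 1, 0, by simp, by simp [leftEnd]⟩
  · exact ⟨1, by simp [weight], 0, 1, by simp, by simp [leftEnd]; ring⟩

theorem isEndpoint_rightEnd (c : Fin 3) : IsEndpoint α β (weight c) (rightEnd α β c) := by
  fin_cases c
  · exact ⟨1, by simp [weight], 1, 0, by simp, by simp [rightEnd]⟩
  · exact ⟨1, by simp [weight], 0, 1, by simp, by simp [rightEnd]; ring⟩
  · exact ⟨0, by simp, 1, 0, by simp, by simp [rightEnd]⟩

theorem IsEndpoint.mono {N N' : ℕ} (hN : N ≤ N') {x : ℝ} (h : IsEndpoint α β N x) :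
    IsEndpoint α β N' x := by
  obtain ⟨j, hj, h⟩ := h
  exact ⟨j, hj.trans hN, h⟩

theorem IsEndpoint.sub_translation {N : ℕ} {x : ℝ} (h : IsEndpoint α β N x) (c : Fin 3) :
    IsEndpoint α β (weight c + N) (x - translation α β c) := by
  obtain ⟨j, hj, e, l, he, rfl⟩ := h
  obtain ⟨l', hl'⟩ := exists_translation_eq α β c
  refine ⟨weight c + j, by omega, e, l + l', he, ?_⟩
  rw [hl']
  push_cast
  ring

theorem leftEnd_nonneg (h : IsParameter α β) (c : Fin 3) : 0 ≤ leftEnd α β c := by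
  obtain ⟨hα, hβ, hs, -⟩ := h
  unfold leftEnd
  split_ifs <;> linarith

theorem rightEnd_le_one (h : IsParameter α β) (c : Fin 3) : rightEnd α β c ≤ 1 := by
  obtain ⟨hα, hβ, hs, -⟩ := h
  unfold rightEnd
  split_ifs <;> linarith

/-- Prefixing a letter translates the interval back and cuts it with the interval of that letter;
the endpoints are pulled back by as many rotation steps as the weight of the letter. -/
theorem exists_wordSet_eq (h : IsParameter α β) (w : List (Fin 3)) :
    ∃ a b : ℝ, 0 ≤ a ∧ a ≤ b ∧ b ≤ 1 ∧ wordSet α β w = Set.Ico a b ∧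
      (a < b → IsEndpoint α β (w.map weight).sum a ∧ IsEndpoint α β (w.map weight).sum b) := by
  induction w with
  | nil =>
    exact ⟨0, 1, le_rfl, zero_le_one, le_rfl, wordSet_nil, fun _ =>
      ⟨⟨0, le_rfl, 0, 0, by simp, by simp⟩, ⟨0, le_rfl, 1, 0, by simp, by simp⟩⟩⟩
  | cons c w ih =>
    obtain ⟨a, b, ha, hab, hb, hw, hend⟩ := ih
    set s := translation α β c
    have hset : wordSet α β (c :: w) =
        Set.Ico (max (leftEnd α β c) (a - s)) (min (rightEnd α β c) (b - s)) := by
      rw [← Set.Ico_inter_Ico]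
      ext x
      rw [mem_wordSet_cons h, ← and_assoc, label_eq_iff h, hw, Set.mem_inter_iff]
      refine and_congr_right fun hx => ?_
      rw [exchange_eq, ((label_eq_iff h).2 hx).2, Set.mem_Ico, Set.mem_Ico, sub_le_iff_le_add,
        lt_sub_iff_add_lt]
    rcases lt_or_ge (max (leftEnd α β c) (a - s)) (min (rightEnd α β c) (b - s)) with hlt | hge
    · refine ⟨_, _, (leftEnd_nonneg h c).trans (le_max_left _ _), hlt.le,
        (min_le_left _ _).trans (rightEnd_le_one h c), hset, fun _ => ?_⟩
      have hab' : a < b := by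
        have h1 := (le_max_right _ _).trans_lt (hlt.trans_le (min_le_right _ _))
        linarith
      obtain ⟨ea, eb⟩ := hend hab'
      rw [List.map_cons, List.sum_cons]
      constructor
      · rcases max_choice (leftEnd α β c) (a - s) with h1 | h1 <;> rw [h1]
        · exact (isEndpoint_leftEnd c).mono (by omega)
        · exact ea.sub_translation c
      · rcases min_choice (rightEnd α β c) (b - s) with h1 | h1 <;> rw [h1]
        · exact (isEndpoint_rightEnd c).mono (by omega)
        · exact eb.sub_translation c
    -- An empty intersection is recorded as `[0, 0)`, for which nothing is claimed about endpoints.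
    · exact ⟨0, 0, le_rfl, le_rfl, zero_le_one, by rw [hset, Set.Ico_eq_empty hge.not_gt, Set.Ico_self],
        fun h => absurd h (lt_irrefl _)⟩

theorem sum_weight_block (x : ℝ) (n : ℕ) :
    ((block (trajectory α β x) 0 n).map weight).sum = time α β x n := by
  induction n with
  | zero => simp [block, time]
  | succ n ih => rw [block_succ, List.map_append, List.sum_append, ih, time_succ]; simp [trajectory]

/-- Points with the same word undergo the same translations. -/
theorem iterate_sub_iterate {x x' : ℝ} {n : ℕ}
    (heq : block (trajectory α β x') 0 n = block (trajectory α β x) 0 n) {i : ℕ} (hi : i ≤ n) :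
    (exchange α β)^[i] x - (exchange α β)^[i] x' = x - x' := by
  induction i with
  | zero => simp
  | succ i ih =>
    have h1 := block_eq_iff.1 heq i (by omega)
    simp only [trajectory, zero_add] at h1
    rw [Function.iterate_succ_apply', Function.iterate_succ_apply', exchange_eq, exchange_eq α β
      ((exchange α β)^[i] x'), h1, ← ih (by omega)]
    ring

theorem exists_time_lt_le (x : ℝ) {j n : ℕ} (hj : 1 ≤ j) (hjn : j ≤ time α β x n) :
    ∃ i < n, time α β x i < j ∧ j ≤ time α β x (i + 1) := by
  induction n with
  | zero => simp [time] at hjn; omega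
  | succ n ih =>
    rcases le_or_gt j (time α β x n) with h | h
    · obtain ⟨i, hi, h'⟩ := ih h
      exact ⟨i, by omega, h'⟩
    · exact ⟨n, by omega, h, hjn⟩

theorem eq_zero_of_abs_mul_le {M : ℝ} (hM : 1 < M) {k : ℤ} (h : |k * M| ≤ 1) : k = 0 := by
  by_contra hk
  have h1 : (1 : ℝ) ≤ |(k : ℝ)| := by exact_mod_cast Int.one_le_abs hk
  rw [abs_mul, abs_of_nonneg (by linarith : 0 ≤ M)] at h
  nlinarith

/-- A point whose orbit under the exchange meets a discontinuity is the left endpoint of an interval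
of the partition by trajectories. -/
theorem block_ne_of_iterate_eq (h : IsParameter α β) {x x' : ℝ} (hlt : x' < x) {i n : ℕ}
    (hi : i < n) (hx : (exchange α β)^[i] x = α ∨ (exchange α β)^[i] x = α + β) :
    block (trajectory α β x') 0 n ≠ block (trajectory α β x) 0 n := by
  intro heq
  obtain ⟨hα, hβ, hs, -⟩ := h
  have hdiff := iterate_sub_iterate heq hi.le
  have hlab := block_eq_iff.1 heq i hi
  simp only [trajectory, zero_add] at hlab
  rcases hx with hx | hx <;> rw [hx] at hlab hdiff
  · rw [label_eq_one_iff.2 ⟨le_rfl, by linarith⟩, label_eq_one_iff] at hlab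
    linarith [hlab.1]
  · rw [(label_eq_two_iff hβ).2 le_rfl, label_eq_two_iff hβ] at hlab
    linarith

/-- A point whose orbit under the rotation meets `1` is the left endpoint of an interval of the
partition by trajectories. -/
theorem block_ne_of_lt (h : IsParameter α β) {x x' : ℝ} (hx : x ∈ Set.Ico (0 : ℝ) 1) (hlt : x' < x)
    {j n : ℕ} (hj : 1 ≤ j) (hjn : j ≤ time α β x n) {l : ℤ} (hl : x + j * (1 - α) = 1 + l * (1 + β)) :
    block (trajectory α β x') 0 n ≠ block (trajectory α β x) 0 n := by
  intro heq
  obtain ⟨hα, hβ, hs, -⟩ := id h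
  obtain ⟨i, hi, hi1, hi2⟩ := exists_time_lt_le x hj hjn
  obtain ⟨k, hk⟩ := exists_iterate_eq α β x i
  have hu := iterate_mem h hx i
  have hv := iterate_mem h hx (i + 1)
  have hw := weight_le_two (label α β ((exchange α β)^[i] x))
  obtain ⟨k', hk'⟩ := exists_iterate_eq α β x (i + 1)
  have hts := time_succ (α := α) (β := β) x i
  -- A step of the exchange has at most two rotation steps. Meeting 1 after the first of them forces
  -- the point before the step to be `α`; meeting 1 at the end of the step is impossible in `[0,
  -- 1)`.
  rcases (by omega : j = time α β x i + 1 ∨ j = time α β x (i + 1)) with hj' | hj'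
  · have h0 : l - k = 0 := by
      refine eq_zero_of_abs_mul_le (M := 1 + β) (by linarith) ?_
      have : ((l - k : ℤ) : ℝ) * (1 + β) = (exchange α β)^[i] x - α := by
        rw [hj'] at hl
        push_cast at hl ⊢
        linarith
      rw [this, abs_le]
      constructor <;> linarith [hu.1, hu.2]
    have hux : (exchange α β)^[i] x = α := by
      rw [hj', sub_eq_zero.1 h0] at hl
      push_cast at hl
      linarith
    exact block_ne_of_iterate_eq h hlt hi (Or.inl hux) heq
  · have h0 : l - k' = 0 := by
      refine eq_zero_of_abs_mul_le (M := 1 + β) (by linarith) ?_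
      have : ((l - k' : ℤ) : ℝ) * (1 + β) = (exchange α β)^[i + 1] x - 1 := by
        rw [hj'] at hl
        push_cast at hl ⊢
        linarith
      rw [this, abs_le]
      constructor <;> linarith [hv.1, hv.2]
    rw [hj', sub_eq_zero.1 h0] at hl
    linarith [hv.2]

end ThreeInterval

/-! ### Measures on the space of sequences -/

namespace Symbolic

variable {A : Type*} [MeasurableSpace A]

theorem measurable_shift : Measurable (shift : (ℕ → A) → ℕ → A) :=
  measurable_pi_lambda _ fun n => measurable_pi_apply (n + 1)

theorem measure_cylinder {L : Language A} {μ : Measure (ℕ → A)} (h : μ (system L)ᶜ = 0)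
    (w : List A) : μ (cylinder L w) = μ {x | block x 0 w.length = w} := by
  refine measure_congr ?_
  filter_upwards [mem_ae_iff.2 h] with x hx
  exact propext ⟨fun h => h.2, fun h' => ⟨hx, h'⟩⟩

variable [MeasurableSingletonClass A] [Countable A]

theorem measurableSet_block (r n : ℕ) (P : Set (List A)) :
    MeasurableSet {x : ℕ → A | block x r n ∈ P} := by
  induction n generalizing P with
  | zero => simp [block_zero]
  | succ n ih =>
    have h : {x : ℕ → A | block x r (n + 1) ∈ P} =
        ⋃ c : A, {x | x (r + n) = c} ∩ {x | block x r n ∈ {u | u ++ [c] ∈ P}} := by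
      ext x
      simp [block_succ]
    rw [h]
    exact MeasurableSet.iUnion fun c =>
      (measurableSet_eq_fun (measurable_pi_apply (r + n)) measurable_const).inter (ih _)

theorem measurableSet_system (L : Language A) : MeasurableSet (system L) := by
  have h : system L = ⋂ r : ℕ, ⋂ n : ℕ, {x | block x r n ∈ (L : Set (List A))} := by
    ext x
    simp only [system, Set.mem_iInter]
    rfl
  rw [h]
  exact MeasurableSet.iInter fun r => MeasurableSet.iInter fun n => measurableSet_block r n _

theorem measurableSet_cylinder (L : Language A) (w : List A) : MeasurableSet (cylinder L w) :=
  (measurableSet_system L).inter (measurableSet_block 0 w.length {w})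

/-- A finite measure on the space of sequences is determined by the measures of the sets of
sequences with a given beginning. -/
theorem measure_ext_of_block {μ ν : Measure (ℕ → A)} [IsFiniteMeasure μ]
    (h : ∀ w : List A, μ {x | block x 0 w.length = w} = ν {x | block x 0 w.length = w}) :
    μ = ν := by
  have hP : ∀ (n : ℕ) (P : Set (List A)), μ {x | block x 0 n ∈ P} = ν {x | block x 0 n ∈ P} := by
    intro n P
    have hU : {x : ℕ → A | block x 0 n ∈ P} = ⋃ w : P, {x | block x 0 n = w} := by
      ext x; simp
    have hd : Pairwise (Function.onFun Disjoint fun w : P => {x : ℕ → A | block x 0 n = w}) := by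
      intro w w' hne
      refine Set.disjoint_left.2 fun x hx hx' => hne (Subtype.ext ?_)
      exact (hx : _ = _).symm.trans hx'
    have hm : ∀ w : P, MeasurableSet {x : ℕ → A | block x 0 n = w} := fun w =>
      measurableSet_block 0 n {(w : List A)}
    rw [hU, measure_iUnion hd hm, measure_iUnion hd hm]
    refine tsum_congr fun w => ?_
    by_cases hw : (w : List A).length = n
    · rw [← hw]; exact h w
    · have : {x : ℕ → A | block x 0 n = w} = ∅ := by
        ext x
        simp only [Set.mem_ofPred_eq, Set.mem_empty_iff_false, iff_false]
        intro h'
        exact hw (by rw [← h', length_block])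
      rw [this, measure_empty, measure_empty]
  -- Allowing a set of beginnings makes the family stable under intersection: two conditions, of
  -- lengths `n` and `m`, are both read on the beginning of length `n + m`.
  let C : Set (Set (ℕ → A)) := {S | ∃ (n : ℕ) (P : Set (List A)), S = {x | block x 0 n ∈ P}}
  have hgen : (MeasurableSpace.pi : MeasurableSpace (ℕ → A)) = MeasurableSpace.generateFrom C := by
    apply le_antisymm
    · refine iSup_le fun i => ?_
      rw [MeasurableSpace.comap_le_iff_le_map]
      intro s _
      refine MeasurableSpace.measurableSet_generateFrom
        ⟨i + 1, {u | ∃ v c, c ∈ s ∧ u = v ++ [c]}, ?_⟩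
      ext x
      simp [block_succ]
    · refine MeasurableSpace.generateFrom_le ?_
      rintro _ ⟨n, P, rfl⟩
      exact measurableSet_block 0 n P
  refine ext_of_generate_finite C hgen ?_ ?_ ?_
  · rintro _ ⟨n, P, rfl⟩ _ ⟨m, Q, rfl⟩ -
    refine ⟨n + m, {u | u.take n ∈ P ∧ u.take m ∈ Q}, ?_⟩
    ext x
    simp only [Set.mem_inter_iff, Set.mem_ofPred_eq, take_block x 0 (Nat.le_add_right n m),
      take_block x 0 (Nat.le_add_left m n)]
  · rintro _ ⟨n, P, rfl⟩
    exact hP n P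
  · simpa using hP 0 Set.univ

end Symbolic

/-! ### Uniform frequencies, unique ergodicity and minimality -/

namespace ThreeInterval

open Symbolic

variable {α β : ℝ}

theorem card_block_eq (h : IsParameter α β) {x : ℝ} (hx : x ∈ Set.Ico (0 : ℝ) 1)
    {w : List (Fin 3)} {a b : ℝ} (hw : wordSet α β w = Set.Ico a b) (N : ℕ) :
    ((Finset.range N).filter (fun i => block (trajectory α β x) i w.length = w)).card =
      visitCount α β x a b N := by
  unfold visitCount
  congr 1
  refine Finset.filter_congr fun i _ => ?_
  rw [← hw, block_trajectory]
  exact ⟨fun h' => ⟨iterate_mem h hx i, h'⟩, fun h' => h'.2⟩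

/-- Words occur in `L` with uniform frequencies. -/
theorem exists_uniform_frequency (h : IsParameter α β) {ε : ℝ} (hε : 0 < ε) :
    ∃ C : ℝ, 0 ≤ C ∧ ∀ w : List (Fin 3), ∀ x ∈ system (language α β), ∀ N : ℕ,
      |(((Finset.range N).filter (fun i => block x i w.length = w)).card : ℝ) -
        N * volume.real (wordSet α β w)| ≤ ε * N + C := by
  obtain ⟨C, hC, hfreq⟩ := exists_equidistribution h hε
  refine ⟨C, hC, fun w x hx N => ?_⟩
  obtain ⟨a, b, ha, hab, hb, hw, -⟩ := exists_wordSet_eq h w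
  -- A sequence of the system need not be a trajectory, but it agrees with one on the finite window
  -- that contains the occurrences of `w` starting before `N`.
  obtain ⟨z, hz, hzx⟩ := (mem_language_iff h).1 (hx 0 (N + w.length))
  rw [length_block, block_eq_iff] at hzx
  have hcongr : ∀ i ∈ Finset.range N,
      (block x i w.length = w ↔ block (trajectory α β z) i w.length = w) := by
    intro i hi
    rw [Finset.mem_range] at hi
    have : block x i w.length = block (trajectory α β z) i w.length := by
      rw [block_eq_iff]
      intro k hk
      simpa using (hzx (i + k) (by omega)).symm
    rw [this]
  rw [Finset.filter_congr hcongr, card_block_eq h hz hw, hw, Real.volume_real_Ico_of_le hab]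
  exact (hfreq z hz N).2 a b ha hab hb

theorem volume_wordSet_ne_top (w : List (Fin 3)) : volume (wordSet α β w) ≠ ∞ :=
  ((measure_mono fun _ hx => hx.1).trans_lt (measure_Ico_lt_top (a := (0 : ℝ)) (b := 1))).ne

/-- Integrating the number of occurrences of `w` at the first `N` places gives `N` times its measure
by invariance, while the uniform frequency makes the integrand nearly constant. No ergodic theorem
is involved. -/
theorem measure_block_eq (h : IsParameter α β) {ν : Measure (ℕ → Fin 3)}
    (hν : IsInvariantProbability (language α β) ν) (w : List (Fin 3)) :
    ν {x | block x 0 w.length = w} = volume (wordSet α β w) := by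
  obtain ⟨hprob, hsys, hinv⟩ := hν
  set U : Set (ℕ → Fin 3) := {x | block x 0 w.length = w} with hU
  have hUm : MeasurableSet U := measurableSet_block 0 w.length {w}
  rw [← ENNReal.toReal_eq_toReal_iff' (measure_ne_top _ _) (volume_wordSet_ne_top w)]
  change ν.real U = volume.real (wordSet α β w)
  set v := volume.real (wordSet α β w)
  by_contra hne
  set ε := |ν.real U - v| / 2 with hεdef
  have hε : 0 < ε := by
    have := abs_pos.2 (sub_ne_zero.2 hne)
    positivity
  obtain ⟨C, hC, hfreq⟩ := exists_uniform_frequency h hε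
  have key : ∀ N : ℕ, |N * ν.real U - N * v| ≤ ε * N + C := by
    intro N
    let f : (ℕ → Fin 3) → ℝ := fun x => ∑ i ∈ Finset.range N,
      (shift^[i] ⁻¹' U).indicator (fun _ => (1 : ℝ)) x
    have hm : ∀ i, MeasurableSet (shift^[i] ⁻¹' U) := fun i =>
      (measurable_shift.iterate i) hUm
    have hint : ∀ i ∈ Finset.range N,
        Integrable (fun x => (shift^[i] ⁻¹' U).indicator (fun _ => (1 : ℝ)) x) ν := fun i _ =>
      (integrable_const (1 : ℝ)).indicator (hm i)
    have hf : ∫ x, f x ∂ν = N * ν.real U := by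
      rw [integral_finsetSum _ hint]
      rw [Finset.sum_congr rfl (g := fun _ => ν.real U)]
      · simp
      · intro i _
        rw [integral_indicator (hm i)]
        simp only [integral_const, MeasurableSet.univ, measureReal_restrict_apply, Set.univ_inter,
          smul_eq_mul, mul_one]
        rw [Measure.real, (hinv.iterate i).measure_preimage hUm.nullMeasurableSet, Measure.real]
    have hfi : Integrable f ν := integrable_finsetSum _ hint
    have hbd : ∀ᵐ x ∂ν, ‖f x - N * v‖ ≤ ε * N + C := by
      filter_upwards [mem_ae_iff.2 hsys] with x hx
      have hfx : f x =
          (((Finset.range N).filter (fun i => block x i w.length = w)).card : ℝ) := by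
        simp only [f, Finset.card_filter, Nat.cast_sum]
        refine Finset.sum_congr rfl fun i _ => ?_
        have : x ∈ shift^[i] ⁻¹' U ↔ block x i w.length = w := by
          rw [hU, Set.mem_preimage, Set.mem_ofPred_eq, block_iterate_shift, zero_add]
        by_cases hx' : block x i w.length = w
        · rw [Set.indicator_of_mem (this.2 hx'), if_pos hx']; simp
        · rw [Set.indicator_of_notMem (fun h' => hx' (this.1 h')), if_neg hx']; simp
      rw [hfx]
      exact hfreq w x hx N
    have := norm_integral_le_of_norm_le_const hbd
    rwa [integral_sub hfi (integrable_const _), hf, integral_const, probReal_univ, one_smul,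
      mul_one] at this
  obtain ⟨N, hN⟩ := exists_nat_gt (C / ε)
  rw [div_lt_iff₀ hε] at hN
  have h1 := key N
  rw [← mul_sub, abs_mul, Nat.abs_cast] at h1
  have h2 : |ν.real U - v| = 2 * ε := by rw [hεdef]; ring
  rw [h2] at h1
  linarith

theorem measurable_label : Measurable (label α β) := by
  unfold label
  exact Measurable.ite measurableSet_Iio measurable_const
    (Measurable.ite measurableSet_Iio measurable_const measurable_const)

theorem measurable_exchange : Measurable (exchange α β) := by
  unfold exchange
  exact Measurable.ite measurableSet_Iio (by fun_prop)
    (Measurable.ite measurableSet_Iio (by fun_prop) (by fun_prop))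

theorem measurable_trajectory : Measurable (trajectory α β) :=
  measurable_pi_lambda _ fun n => measurable_label.comp (measurable_exchange.iterate n)

theorem map_exchange_restrict (h : IsParameter α β) (c : Fin 3) :
    (volume.restrict (Set.Ico (leftEnd α β c) (rightEnd α β c))).map (exchange α β) =
      volume.restrict (Set.Ico (leftEnd α β c + translation α β c)
        (rightEnd α β c + translation α β c)) := by
  have h1 := ((measurePreserving_add_right volume (translation α β c)).restrict_preimage
    (s := Set.Ico (leftEnd α β c + translation α β c) (rightEnd α β c + translation α β c))
    measurableSet_Ico).map_eq
  rw [Set.preimage_add_const_Ico, add_sub_cancel_right, add_sub_cancel_right] at h1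
  rw [← h1]
  refine Measure.map_congr ?_
  filter_upwards [ae_restrict_mem measurableSet_Ico] with x hx
  rw [exchange_eq, ((label_eq_iff h).2 hx).2]

theorem restrict_Ico_eq_add_add {a b c d : ℝ} (hab : a ≤ b) (hbc : b ≤ c) (hcd : c ≤ d) :
    (volume : Measure ℝ).restrict (Set.Ico a d) = volume.restrict (Set.Ico a b) +
      volume.restrict (Set.Ico b c) + volume.restrict (Set.Ico c d) := by
  rw [← Set.Ico_union_Ico_eq_Ico (hab.trans hbc) hcd, ← Set.Ico_union_Ico_eq_Ico hab hbc,
    Measure.restrict_union _ measurableSet_Ico, Measure.restrict_union _ measurableSet_Ico]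
  · simp
  · rw [Set.Ico_union_Ico_eq_Ico hab hbc]
    simp

/-- The exchange preserves Lebesgue measure on `[0, 1)`. -/
theorem measurePreserving_exchange (h : IsParameter α β) :
    MeasurePreserving (exchange α β) (volume.restrict (Set.Ico (0 : ℝ) 1))
      (volume.restrict (Set.Ico (0 : ℝ) 1)) := by
  refine ⟨measurable_exchange, ?_⟩
  have h0 := map_exchange_restrict h 0
  have h1 := map_exchange_restrict h 1
  have h2 := map_exchange_restrict h 2
  obtain ⟨hα, hβ, hs, -⟩ := h
  simp only [leftEnd, rightEnd, translation, if_true, one_ne_zero, if_false, Fin.reduceEq,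
    Fin.isValue] at h0 h1 h2
  rw [restrict_Ico_eq_add_add hα.le (by linarith : α ≤ α + β) hs.le,
    Measure.map_add _ _ measurable_exchange, Measure.map_add _ _ measurable_exchange, h0, h1, h2,
    ← restrict_Ico_eq_add_add hα.le (by linarith : α ≤ α + β) hs.le,
    restrict_Ico_eq_add_add (a := 0) (d := 1) (b := 1 - α - β) (c := 1 - α) (by linarith) (by linarith)
      (by linarith)]
  -- The images of the three intervals tile `[0, 1)` in the reverse order.
  rw [show 0 + (1 - α) = 1 - α by ring, show α + (1 - α) = 1 by ring,
    show α + (1 - 2 * α - β) = 1 - α - β by ring, show α + β + (1 - 2 * α - β) = 1 - α by ring,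
    show α + β + (-α - β) = 0 by ring, show 1 + (-α - β) = 1 - α - β by ring]
  abel

/-- The invariant measure: the distribution of the trajectory of a uniformly distributed point. -/
noncomputable def trajectoryMeasure (α β : ℝ) : Measure (ℕ → Fin 3) :=
  (volume.restrict (Set.Ico (0 : ℝ) 1)).map (trajectory α β)

theorem isInvariantProbability_trajectoryMeasure (h : IsParameter α β) :
    IsInvariantProbability (language α β) (trajectoryMeasure α β) := by
  have hprob : IsProbabilityMeasure (volume.restrict (Set.Ico (0 : ℝ) 1)) := ⟨by simp⟩
  refine ⟨Measure.isProbabilityMeasure_map measurable_trajectory.aemeasurable, ?_,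
    measurable_shift, ?_⟩
  · rw [trajectoryMeasure, Measure.map_apply measurable_trajectory
      (measurableSet_system _).compl, Measure.restrict_apply
      (measurable_trajectory (measurableSet_system _).compl)]
    convert measure_empty (μ := (volume : Measure ℝ))
    ext x
    simp only [Set.mem_inter_iff, Set.mem_preimage, Set.mem_compl_iff, Set.mem_empty_iff_false,
      iff_false, not_and]
    intro hx hx01
    exact hx fun r n => ⟨x, hx01, r, n, rfl⟩
  · rw [trajectoryMeasure, Measure.map_map measurable_shift measurable_trajectory]
    have : shift ∘ trajectory α β = trajectory α β ∘ exchange α β := by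
      funext x
      exact shift_trajectory x
    rw [this, ← Measure.map_map measurable_trajectory measurable_exchange,
      (measurePreserving_exchange h).map_eq]

theorem isUniqueInvariantProbability_trajectoryMeasure (h : IsParameter α β) :
    IsUniqueInvariantProbability (language α β) (trajectoryMeasure α β) := by
  have h0 := isInvariantProbability_trajectoryMeasure h
  refine ⟨h0, fun ν hν => ?_⟩
  have := hν.1
  exact measure_ext_of_block fun w => by rw [measure_block_eq h hν, measure_block_eq h h0]

theorem measure_cylinder_eq (h : IsParameter α β) {μ : Measure (ℕ → Fin 3)}
    (hμ : IsInvariantProbability (language α β) μ) (w : List (Fin 3)) :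
    μ (cylinder (language α β) w) = volume (wordSet α β w) := by
  rw [measure_cylinder hμ.2.1, measure_block_eq h hμ]

theorem volume_wordSet_pos (h : IsParameter α β) {w : List (Fin 3)} (hw : w ∈ language α β) :
    0 < volume (wordSet α β w) := by
  obtain ⟨a, b, -, -, -, hab, -⟩ := exists_wordSet_eq h w
  have hne := (mem_language_iff h).1 hw
  rw [hab] at hne ⊢
  simpa using Set.nonempty_Ico.1 hne

/-- With an error of half the frequency of `w`, the number of occurrences at the first `N` places is
positive for `N` large, uniformly in the trajectory. -/
theorem isMinimal_language (h : IsParameter α β) : IsMinimal (language α β) := by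
  intro w hw
  have hv : 0 < volume.real (wordSet α β w) :=
    ENNReal.toReal_pos (volume_wordSet_pos h hw).ne' (volume_wordSet_ne_top w)
  set v := volume.real (wordSet α β w)
  obtain ⟨C, hC, hfreq⟩ := exists_uniform_frequency h (half_pos hv)
  obtain ⟨N, hN⟩ := exists_nat_gt (C / (v / 2))
  rw [div_lt_iff₀ (half_pos hv)] at hN
  refine ⟨N + w.length, fun u hu hlen => ?_⟩
  obtain ⟨x, hx, hxu⟩ := (mem_language_iff h).1 hu
  have h1 := hfreq w (trajectory α β x) (fun r n => ⟨x, hx, r, n, rfl⟩) N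
  have h2 : 0 < ((Finset.range N).filter
      (fun i => block (trajectory α β x) i w.length = w)).card := by
    rw [Nat.pos_iff_ne_zero]
    intro h0
    rw [h0, abs_le] at h1
    push_cast at h1
    linarith [h1.1]
  obtain ⟨i, hi⟩ := Finset.card_pos.1 h2
  rw [Finset.mem_filter, Finset.mem_range] at hi
  rw [← hxu, hlen]
  refine ⟨(block (trajectory α β x) 0 (N + w.length)).take i,
    (block (trajectory α β x) 0 (N + w.length)).drop (i + w.length), ?_⟩
  have h3 : w = ((block (trajectory α β x) 0 (N + w.length)).drop i).take w.length := by
    nth_rewrite 1 [← hi.2]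
    refine List.ext_getElem (by simp [block]; omega) fun k hk hk' => ?_
    simp [block]
  nth_rewrite 2 [h3]
  rw [List.append_assoc, ← List.drop_drop, List.take_append_drop, List.take_append_drop]

end ThreeInterval

/-! ### Bounds for the smallest frequency, and the inequality 𝓑' ≥ 2 -/

namespace ThreeInterval

open Symbolic

variable {α β : ℝ} {μ : Measure (ℕ → Fin 3)}

theorem minFreq_le_measure (h : IsParameter α β) (hμ : IsInvariantProbability (language α β) μ)
    {x : ℝ} (hx : x ∈ Set.Ico (0 : ℝ) 1) (n : ℕ) :
    minFreq (language α β) μ n ≤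
      μ (cylinder (language α β) (block (trajectory α β x) 0 n)) := by
  have hL : block (trajectory α β x) 0 n ∈ language α β := ⟨x, hx, 0, n, rfl⟩
  refine sInf_le ⟨_, hL, length_block _ _ _, rfl, ?_⟩
  rw [measure_cylinder_eq h hμ]
  exact volume_wordSet_pos h hL

theorem minFreq_le_of_subset (h : IsParameter α β) (hμ : IsInvariantProbability (language α β) μ)
    {x : ℝ} (hx : x ∈ Set.Ico (0 : ℝ) 1) {n : ℕ} {u v : ℝ}
    (hsub : wordSet α β (block (trajectory α β x) 0 n) ⊆ Set.Ico u v) :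
    minFreq (language α β) μ n ≤ ENNReal.ofReal (v - u) := by
  refine (minFreq_le_measure h hμ hx n).trans ?_
  rw [measure_cylinder_eq h hμ, ← Real.volume_Ico]
  exact measure_mono hsub

/-- If the orbit of a small `d > 0`, or of `1 - d`, under the rotation meets `1` soon enough, then
`e_n ≤ d`. -/
theorem exists_minFreq_le (h : IsParameter α β) (hμ : IsInvariantProbability (language α β) μ)
    {ε : ℝ} (hε : 0 < ε) :
    ∃ C : ℝ, 0 ≤ C ∧ ∀ (n j : ℕ) (l : ℤ) (d : ℝ), 0 < d → d < 1 → 1 ≤ j →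
      (j : ℝ) ≤ (1 + β - ε) * n - C →
      (d = 1 - j * (1 - α) + l * (1 + β) ∨ d = j * (1 - α) - l * (1 + β)) →
      minFreq (language α β) μ n ≤ ENNReal.ofReal d := by
  obtain ⟨C, hC, hdist⟩ := exists_equidistribution h hε
  refine ⟨C, hC, fun n j l d hd0 hd1 hj hjn hd => ?_⟩
  have hjt : ∀ x ∈ Set.Ico (0 : ℝ) 1, j ≤ time α β x n := by
    intro x hx
    have h1 := (hdist x hx n).1
    rw [abs_le] at h1
    have : (j : ℝ) ≤ time α β x n := by linarith [h1.1]
    exact_mod_cast this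
  rcases hd with hd | hd
  · have h0 : (0 : ℝ) ∈ Set.Ico (0 : ℝ) 1 := ⟨le_rfl, zero_lt_one⟩
    have hd' : d ∈ Set.Ico (0 : ℝ) 1 := ⟨hd0.le, hd1⟩
    have hne := block_ne_of_lt h hd' hd0 hj (hjt d hd') (l := l) (by linarith)
    -- The word of 0 has an interval that contains 0 but not `d`.
    have hsub : wordSet α β (block (trajectory α β 0) 0 n) ⊆ Set.Ico 0 d := by
      intro y hy
      refine ⟨hy.1.1, ?_⟩
      by_contra! hdy
      obtain ⟨a, b, -, -, -, hw, -⟩ := exists_wordSet_eq h (block (trajectory α β 0) 0 n)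
      have h0w := mem_wordSet_block (α := α) (β := β) h0 n
      rw [hw] at h0w hy
      have hdw : d ∈ wordSet α β (block (trajectory α β 0) 0 n) := by
        rw [hw]
        exact ⟨h0w.1.trans hd0.le, hdy.trans_lt hy.2⟩
      have := hdw.2
      rw [length_block] at this
      exact hne this.symm
    simpa using minFreq_le_of_subset h hμ h0 hsub
  · have hx : 1 - d ∈ Set.Ico (0 : ℝ) 1 := ⟨by linarith, by linarith⟩
    -- Here `1 - d` is the point that meets 1, so it is the left end of its own interval.
    have hsub : wordSet α β (block (trajectory α β (1 - d)) 0 n) ⊆ Set.Ico (1 - d) 1 := by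
      intro y hy
      refine ⟨?_, hy.1.2⟩
      by_contra! hlt
      refine block_ne_of_lt h hx hlt hj (hjt _ hx) (l := l) (by linarith) ?_
      have := hy.2
      rwa [length_block] at this
    simpa using minFreq_le_of_subset h hμ hx hsub

/-- If `0` and `1` do not come back too soon too close to `0` under the rotation, then `d ≤ e_n`. -/
theorem exists_le_minFreq (h : IsParameter α β) (hμ : IsInvariantProbability (language α β) μ)
    {ε : ℝ} (hε : 0 < ε) :
    ∃ C : ℝ, 0 ≤ C ∧ ∀ (n : ℕ) (d : ℝ), d ≤ 1 →
      (∀ j l : ℤ, |(j : ℝ)| ≤ (1 + β + ε) * n + C → j ≠ 0 →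
        d ≤ |j * (1 - α) + l * (1 + β)|) →
      (∀ j l : ℤ, |(j : ℝ)| ≤ (1 + β + ε) * n + C → d ≤ |1 + j * (1 - α) + l * (1 + β)|) →
      ENNReal.ofReal d ≤ minFreq (language α β) μ n := by
  obtain ⟨C, hC, hdist⟩ := exists_equidistribution h hε
  refine ⟨C, hC, fun n d hd1 h0 h1 => le_sInf ?_⟩
  rintro _ ⟨w, hwL, rfl, rfl, -⟩
  have hβ := h.2.1
  rw [measure_cylinder_eq h hμ]
  obtain ⟨x, hx⟩ := (mem_language_iff h).1 hwL
  obtain ⟨a, b, ha, hab, hb, hw, hend⟩ := exists_wordSet_eq h w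
  have hab' : a < b := by
    have := hx
    rw [hw] at this
    exact this.1.trans_lt this.2
  obtain ⟨⟨j, hj, e, l, he, hae⟩, ⟨j', hj', e', l', he', hbe⟩⟩ := hend hab'
  rw [← hx.2, sum_weight_block] at hj hj'
  have hjj : |((j - j' : ℤ) : ℝ)| ≤ (1 + β + ε) * w.length + C := by
    have h2 := (hdist x hx.1 w.length).1
    rw [abs_le] at h2
    have h3 : (j : ℝ) ≤ time α β x w.length := by exact_mod_cast hj
    have h4 : (j' : ℝ) ≤ time α β x w.length := by exact_mod_cast hj'
    have h5 : (0 : ℝ) ≤ j := by positivity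
    have h6 : (0 : ℝ) ≤ j' := by positivity
    rw [abs_le]
    push_cast
    constructor <;> linarith [h2.2]
  rw [hw, Real.volume_Ico]
  refine ENNReal.ofReal_le_ofReal ?_
  -- The length is a return of the rotation near 0 when both ends come from the same point, and a
  -- displacement between 0 and 1 otherwise. If moreover `j = j'`, it is a positive multiple of `1 +
  -- β > 1 ≥ d`.
  have hba : b - a = (e' - e) + (j - j' : ℤ) * (1 - α) + (l' - l : ℤ) * (1 + β) := by
    rw [hae, hbe]
    push_cast
    ring
  have hpos : |b - a| = b - a := abs_of_pos (by linarith)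
  rcases (by rcases he with rfl | rfl <;> rcases he' with rfl | rfl <;> simp :
    e' - e = 0 ∨ e' - e = 1 ∨ e' - e = -1) with hee | hee | hee
  · have hee' : ((e' : ℝ) - e) = 0 := by exact_mod_cast hee
    by_cases hj0 : (j - j' : ℤ) = 0
    · rw [hee', hj0] at hba
      have hl : 1 ≤ l' - l := by
        by_contra! hlt
        have h7 : ((l' - l : ℤ) : ℝ) ≤ 0 := by exact_mod_cast (by omega : l' - l ≤ 0)
        push_cast at hba h7
        nlinarith
      have h7 : (1 : ℝ) ≤ (l' - l : ℤ) := by exact_mod_cast hl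
      push_cast at hba h7
      nlinarith
    · have h7 := h0 _ (l' - l) hjj hj0
      rwa [show ((j - j' : ℤ) : ℝ) * (1 - α) + (l' - l : ℤ) * (1 + β) = b - a by
        rw [hba, hee', zero_add], hpos] at h7
  · have hee' : ((e' : ℝ) - e) = 1 := by exact_mod_cast hee
    have h7 := h1 _ (l' - l) hjj
    rw [hee'] at hba
    rwa [← hba, hpos] at h7
  · have hee' : ((e' : ℝ) - e) = -1 := by exact_mod_cast hee
    have h7 := h1 (-(j - j')) (-(l' - l)) (by rwa [Int.cast_neg, abs_neg])
    rwa [show (1 : ℝ) + (-(j - j') : ℤ) * (1 - α) + (-(l' - l) : ℤ) * (1 + β) = -(b - a) by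
      rw [hba, hee']; push_cast; ring, abs_neg, hpos] at h7

theorem exists_exchange_eq (h : IsParameter α β) {y : ℝ} (hy : y ∈ Set.Ico (0 : ℝ) 1) :
    ∃ x ∈ Set.Ico (0 : ℝ) 1, exchange α β x = y := by
  obtain ⟨hα, hβ, hs, -⟩ := h
  obtain ⟨h0, h1⟩ := hy
  rcases lt_or_ge y (1 - α - β) with h2 | h2
  · refine ⟨y + α + β, ⟨by linarith, by linarith⟩, ?_⟩
    rw [exchange, if_neg (by linarith), if_neg (by linarith)]
    ring
  · rcases lt_or_ge y (1 - α) with h3 | h3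
    · refine ⟨y - (1 - 2 * α - β), ⟨by linarith, by linarith⟩, ?_⟩
      rw [exchange, if_neg (by linarith), if_pos (by linarith)]
      ring
    · refine ⟨y - (1 - α), ⟨by linarith, by linarith⟩, ?_⟩
      rw [exchange, if_pos (by linarith)]
      ring

theorem exists_iterate_exchange_eq (h : IsParameter α β) (i : ℕ) {y : ℝ}
    (hy : y ∈ Set.Ico (0 : ℝ) 1) : ∃ x ∈ Set.Ico (0 : ℝ) 1, (exchange α β)^[i] x = y := by
  induction i generalizing y with
  | zero => exact ⟨y, hy, rfl⟩
  | succ i ih =>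
    obtain ⟨z, hz, hzy⟩ := exists_exchange_eq h hy
    obtain ⟨x, hx, hxz⟩ := ih hz
    exact ⟨x, hx, by rw [Function.iterate_succ_apply', hxz, hzy]⟩

/-- The two discontinuities of the exchange. -/
noncomputable def discontinuity (α β : ℝ) (c : Bool) : ℝ := if c then α + β else α

theorem le_time (x : ℝ) (n : ℕ) : n ≤ time α β x n := by
  have h := Finset.card_nsmul_le_sum (Finset.range n)
    (fun i => weight (label α β ((exchange α β)^[i] x))) 1 fun i _ => one_le_weight _
  simpa [time] using h

/-- The i.d.o.c. condition: the orbits of the discontinuities are infinite and disjoint. -/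
theorem iterate_discontinuity_ne (h : IsParameter α β) {m : ℕ} (hm : 1 ≤ m) (c c' : Bool) :
    (exchange α β)^[m] (discontinuity α β c) ≠ discontinuity α β c' := by
  intro heq
  obtain ⟨k, hk⟩ := exists_iterate_eq α β (discontinuity α β c) m
  have ht := le_time (α := α) (β := β) (discontinuity α β c) m
  set τ := time α β (discontinuity α β c) m
  rw [heq] at hk
  cases c <;> cases c' <;> simp only [discontinuity, if_true, if_false, Bool.false_eq_true] at hk
  · have := ((h.2.2.2 τ k).1 (by push_cast; linarith)).1
    omega
  · refine (h.2.2.2 τ (k + 1)).2.1 ?_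
    push_cast
    linarith
  · refine (h.2.2.2 τ (k - 1)).2.2 ?_
    push_cast
    linarith
  · have := ((h.2.2.2 τ k).1 (by push_cast; linarith)).1
    omega

/-- The `2 n` preimages of the discontinuities of order less than `n` are distinct by i.d.o.c., and
each begins an interval of level `n`; so at least `2 n` disjoint cylinders share the total mass 1.
-/
theorem two_mul_minFreq_le (h : IsParameter α β) (hμ : IsInvariantProbability (language α β) μ)
    (n : ℕ) : 2 * (n * minFreq (language α β) μ n) ≤ 1 := by
  have hprob := hμ.1
  obtain ⟨hα, hβ, hs, -⟩ := id h
  have hdisc : ∀ c, discontinuity α β c ∈ Set.Ico (0 : ℝ) 1 := by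
    intro c
    unfold discontinuity
    split_ifs <;> constructor <;> linarith
  choose f hf hfd using fun p : Fin n × Bool => exists_iterate_exchange_eq h p.1 (hdisc p.2)
  have hfinj : Function.Injective f := by
    have haux : ∀ p q : Fin n × Bool, f p = f q → (p.1 : ℕ) ≤ q.1 → p = q := by
      intro p q hpq hle
      rcases hle.eq_or_lt with h1 | h1
      · have h2 : discontinuity α β p.2 = discontinuity α β q.2 := by
          rw [← hfd p, ← hfd q, hpq, h1]
        refine Prod.ext (Fin.ext h1) ?_
        unfold discontinuity at h2
        rcases p with ⟨i, _ | _⟩ <;> rcases q with ⟨i', _ | _⟩ <;> simp_all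
      · exfalso
        have h2 := hfd q
        rw [← hpq, ← Nat.sub_add_cancel h1.le, Function.iterate_add_apply, hfd p] at h2
        exact iterate_discontinuity_ne h (by omega) _ _ h2
    intro p q hpq
    rcases le_total (p.1 : ℕ) q.1 with h1 | h1
    · exact haux p q hpq h1
    · exact (haux q p hpq.symm h1).symm
  have hlt : ∀ p q, f p < f q →
      block (trajectory α β (f p)) 0 n ≠ block (trajectory α β (f q)) 0 n := by
    intro p q hpq
    refine block_ne_of_iterate_eq h hpq q.1.2 ?_
    rw [hfd q]
    unfold discontinuity
    split_ifs <;> simp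
  have hne : ∀ p q, p ≠ q →
      block (trajectory α β (f p)) 0 n ≠ block (trajectory α β (f q)) 0 n := by
    intro p q hpq
    rcases lt_or_gt_of_ne (hfinj.ne hpq) with h1 | h1
    · exact hlt p q h1
    · exact (hlt q p h1).symm
  have hsum : ∑ p : Fin n × Bool,
      μ (cylinder (language α β) (block (trajectory α β (f p)) 0 n)) ≤ 1 := by
    rw [← measure_biUnion_finset _ fun p _ => measurableSet_cylinder _ _]
    · exact prob_le_one
    · intro p _ q _ hpq
      refine Set.disjoint_left.2 fun x hx hx' => hne p q hpq ?_
      have h1 := hx.2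
      have h2 := hx'.2
      rw [length_block] at h1 h2
      exact h1.symm.trans h2
  refine le_trans ?_ hsum
  refine le_trans ?_ (Finset.sum_le_sum fun p _ => minFreq_le_measure h hμ (hf p) n)
  rw [Finset.sum_const, Finset.card_univ, Fintype.card_prod, Fintype.card_fin, Fintype.card_bool,
    nsmul_eq_mul]
  push_cast
  rw [← mul_assoc, mul_comm (2 : ℝ≥0∞)]

theorem two_le_lowerB (h : IsParameter α β) (hμ : IsInvariantProbability (language α β) μ) :
    2 ≤ lowerB (language α β) μ := by
  refine le_liminf_of_le (by isBoundedDefault) (Eventually.of_forall fun n => ?_)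
  rw [one_div, ENNReal.le_inv_iff_mul_le]
  exact two_mul_minFreq_le h hμ n

end ThreeInterval

/-! ### Construction of the rotation number and of the marked point -/

namespace Approximation

/-- The solution of the recurrence `u (k + 2) = (k + 100) u (k + 1) - u k` with given initial
values. -/
def recurrence (u v : ℤ) : ℕ → ℤ
  | 0 => u
  | 1 => v
  | k + 2 => (k + 100) * recurrence u v (k + 1) - recurrence u v k

/-- The denominators of the approximations of the rotation number. -/
def den : ℕ → ℤ := recurrence 5 7

/-- The numerators of the approximations of the rotation number. -/
def num : ℕ → ℤ := recurrence 2 3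

theorem den_add_two (k : ℕ) : den (k + 2) = (k + 100) * den (k + 1) - den k := rfl

theorem num_add_two (k : ℕ) : num (k + 2) = (k + 100) * num (k + 1) - num k := rfl

theorem den_pos_and_lt (k : ℕ) : 0 < den k ∧ den k < den (k + 1) := by
  induction k with
  | zero => decide
  | succ k ih =>
    obtain ⟨h1, h2⟩ := ih
    refine ⟨by omega, ?_⟩
    rw [den_add_two]
    nlinarith [Int.natCast_nonneg k]

theorem den_pos (k : ℕ) : 0 < den k := (den_pos_and_lt k).1

theorem strictMono_den : StrictMono den := strictMono_nat_of_lt_succ fun k => (den_pos_and_lt k).2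

theorem le_den_add_two (k : ℕ) : (k + 99) * den (k + 1) ≤ den (k + 2) := by
  rw [den_add_two]
  linarith [(den_pos_and_lt k).2]

theorem natCast_le_den (k : ℕ) : (k : ℤ) ≤ den k := by
  induction k with
  | zero => exact (den_pos 0).le
  | succ k ih => have := (den_pos_and_lt k).2; push_cast; omega

/-- The minus sign in the recurrence preserves this determinant, sign included: the fractions
increase, so all approximations of `theta` are from below. -/
theorem num_mul_den_sub (k : ℕ) : num (k + 1) * den k - num k * den (k + 1) = 1 := by
  induction k with
  | zero => decide
  | succ k ih =>
    rw [num_add_two, den_add_two]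
    linear_combination ih

theorem isCoprime_num_den (k : ℕ) : IsCoprime (num (k + 1)) (den (k + 1)) :=
  ⟨den k, -num k, by linear_combination num_mul_den_sub k⟩

theorem cast_den_pos (k : ℕ) : (0 : ℝ) < den k := by exact_mod_cast den_pos k

theorem cast_num_mul_den_sub (k : ℕ) :
    (num (k + 1) * den k - num k * den (k + 1) : ℝ) = 1 := by
  exact_mod_cast num_mul_den_sub k

/-- The rotation number. -/
noncomputable def theta : ℝ := ⨆ k, (num k / den k : ℝ)

theorem div_succ_sub_div (k : ℕ) :
    (num (k + 1) / den (k + 1) : ℝ) = num k / den k + 1 / (den k * den (k + 1)) := by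
  have h1 := (cast_den_pos k).ne'
  have h2 := (cast_den_pos (k + 1)).ne'
  field_simp
  linear_combination cast_num_mul_den_sub k

/-- The successive increments `1 / (den k * den (k + 1))` at least halve each time, so their sum is
at most twice the first. -/
theorem theta_mem (k : ℕ) :
    theta ∈ Set.Icc (num k / den k : ℝ) (num k / den k + 2 / (den k * den (k + 1))) := by
  have hmono : Monotone fun k => (num k / den k : ℝ) := by
    refine monotone_nat_of_le_succ fun k => ?_
    have h1 := cast_den_pos k
    have h2 := cast_den_pos (k + 1)
    rw [div_succ_sub_div]
    have : (0 : ℝ) < 1 / (den k * den (k + 1)) := by positivity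
    linarith
  have hanti : Antitone fun k => (num k / den k + 2 / (den k * den (k + 1)) : ℝ) := by
    refine antitone_nat_of_succ_le fun k => ?_
    have h1 := cast_den_pos k
    have h2 := cast_den_pos (k + 1)
    have h3 := cast_den_pos (k + 2)
    have h4 : (2 * den k : ℝ) ≤ den (k + 2) := by
      have h5 := le_den_add_two k
      have h6 := (den_pos_and_lt k).2
      have : 2 * den k ≤ den (k + 2) := by nlinarith [den_pos (k + 1), Int.natCast_nonneg k]
      exact_mod_cast this
    rw [div_succ_sub_div]
    have : (2 : ℝ) / (den (k + 1) * den (k + 2)) ≤ 1 / (den k * den (k + 1)) := by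
      rw [div_le_div_iff₀ (by positivity) (by positivity)]
      nlinarith
    have h7 : (2 : ℝ) / (den k * den (k + 1)) =
      1 / (den k * den (k + 1)) + 1 / (den k * den (k + 1)) := by ring
    rw [h7]
    linarith
  have h := hmono.ciSup_mem_iInter_Icc_of_antitone hanti fun k => by
    have h1 := cast_den_pos k
    have h2 := cast_den_pos (k + 1)
    exact le_add_of_nonneg_right (by positivity)
  exact Set.mem_iInter.1 h k

/-- The errors of the approximations. -/
noncomputable def delta (k : ℕ) : ℝ := den k * theta - num k

theorem delta_add_two (k : ℕ) : delta k + delta (k + 2) = (k + 100) * delta (k + 1) := by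
  unfold delta
  rw [den_add_two, num_add_two]
  push_cast
  ring

theorem delta_mul_den (k : ℕ) : den (k + 1) * delta k = 1 + den k * delta (k + 1) := by
  unfold delta
  linear_combination cast_num_mul_den_sub k

theorem delta_nonneg (k : ℕ) : 0 ≤ delta k := by
  have h := (theta_mem k).1
  rw [div_le_iff₀ (cast_den_pos k)] at h
  unfold delta
  linarith

theorem one_div_le_delta (k : ℕ) : 1 ≤ den (k + 1) * delta k := by
  rw [delta_mul_den]
  have := mul_nonneg (cast_den_pos k).le (delta_nonneg (k + 1))
  linarith

theorem delta_pos (k : ℕ) : 0 < delta k := by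
  have h1 := one_div_le_delta k
  exact pos_of_mul_pos_right (by linarith : 0 < den (k + 1) * delta k) (cast_den_pos (k + 1)).le

theorem den_mul_delta_le_two (k : ℕ) : den (k + 1) * delta k ≤ 2 := by
  have h := (theta_mem k).2
  have h1 := cast_den_pos k
  have h2 := cast_den_pos (k + 1)
  have h3 : delta k = den k * (theta - num k / den k) := by
    unfold delta
    field_simp
  have h4 : theta - num k / den k ≤ 2 / (den k * den (k + 1)) := by linarith
  rw [h3]
  calc (den (k + 1) : ℝ) * (den k * (theta - num k / den k))
      ≤ den (k + 1) * (den k * (2 / (den k * den (k + 1)))) := by gcongr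
    _ = 2 := by field_simp

theorem den_mul_delta_le (k : ℕ) : (k + 99) * (den (k + 1) * delta (k + 1)) ≤ 2 := by
  have h1 := den_mul_delta_le_two (k + 1)
  have h2 : ((k + 99) * den (k + 1) : ℝ) ≤ den (k + 2) := by exact_mod_cast le_den_add_two k
  nlinarith [delta_pos (k + 1)]

theorem delta_succ_le (k : ℕ) : 3 * delta (k + 1) ≤ delta k := by
  have h1 := one_div_le_delta k
  have h2 := den_mul_delta_le k
  have h3 := cast_den_pos (k + 1)
  have h4 : (den (k + 1) * (3 * delta (k + 1)) : ℝ) ≤ den (k + 1) * delta k := by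
    nlinarith [mul_pos h3 (delta_pos (k + 1)), (Nat.cast_nonneg k : (0 : ℝ) ≤ k),
      mul_nonneg (Nat.cast_nonneg k : (0 : ℝ) ≤ k) (mul_pos h3 (delta_pos (k + 1))).le]
  exact le_of_mul_le_mul_left h4 h3

theorem tendsto_den_mul_delta_self :
    Tendsto (fun k => den k * delta k) atTop (𝓝 0) := by
  rw [← tendsto_add_atTop_iff_nat 1]
  have h : Tendsto (fun k : ℕ => (2 : ℝ) / ((k : ℝ) + 99)) atTop (𝓝 0) :=
    tendsto_const_nhds.div_atTop
      (tendsto_atTop_add_const_right _ _ tendsto_natCast_atTop_atTop)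
  refine squeeze_zero (fun k => (mul_pos (cast_den_pos _) (delta_pos _)).le) (fun k => ?_) h
  rw [le_div_iff₀ (by positivity)]
  linarith [den_mul_delta_le k]

theorem tendsto_den_atTop : Tendsto (fun k => (den k : ℝ)) atTop atTop :=
  tendsto_atTop_mono (fun k => by exact_mod_cast natCast_le_den k) tendsto_natCast_atTop_atTop

theorem tendsto_delta : Tendsto delta atTop (𝓝 0) := by
  refine squeeze_zero (fun k => (delta_pos k).le) (fun k => ?_) tendsto_den_mul_delta_self
  have : (1 : ℝ) ≤ den k := by exact_mod_cast den_pos k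
  nlinarith [delta_pos k]

theorem tendsto_den_succ_mul_delta :
    Tendsto (fun k => den (k + 1) * delta k) atTop (𝓝 1) := by
  have h : Tendsto (fun k => 1 + den (k + 1) * delta (k + 1)) atTop (𝓝 (1 + 0)) :=
    tendsto_const_nhds.add ((tendsto_add_atTop_iff_nat 1).2 tendsto_den_mul_delta_self)
  rw [add_zero] at h
  refine tendsto_of_tendsto_of_tendsto_of_le_of_le tendsto_const_nhds h one_div_le_delta
    fun k => ?_
  have h1 : (den k : ℝ) ≤ den (k + 1) := by exact_mod_cast (den_pos_and_lt k).2.le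
  simp only [delta_mul_den]
  nlinarith [delta_pos (k + 1)]

/-- For a rational with denominator `b`, the positive errors would be at least `1 / b`, but they
tend to 0. -/
theorem irrational_theta : Irrational theta := by
  rintro ⟨r, hr⟩
  have hb : (0 : ℝ) < r.den := by exact_mod_cast r.den_pos
  have h1 : ∀ k, 1 / (r.den : ℝ) ≤ delta k := by
    intro k
    have h2 : delta k * r.den = (den k * r.num - num k * r.den : ℤ) := by
      have h3 : (r.num : ℝ) = r * r.den := by
        have := Rat.mul_den_eq_num r
        exact_mod_cast this.symm
      unfold delta
      rw [← hr]
      push_cast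
      rw [h3]
      ring
    have h4 : (0 : ℝ) < (den k * r.num - num k * r.den : ℤ) := by
      rw [← h2]
      exact mul_pos (delta_pos k) hb
    have h5 : (1 : ℤ) ≤ den k * r.num - num k * r.den := by exact_mod_cast h4
    rw [div_le_iff₀ hb, h2]
    exact_mod_cast h5
  have := ge_of_tendsto' tendsto_delta h1
  have : 0 < 1 / (r.den : ℝ) := by positivity
  linarith

/-- Multiplied by `den k`, the number `i * theta + l` is an integer up to the error `i * delta k`.
-/
theorem sub_le_den_mul_abs (k : ℕ) (i l : ℤ) :
    |((i * num k + l * den k : ℤ) : ℝ)| - |(i : ℝ)| * delta k ≤ den k * |i * theta + l| := by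
  have h1 : (den k : ℝ) * (i * theta + l) = i * delta k + (i * num k + l * den k : ℤ) := by
    unfold delta
    push_cast
    ring
  have h2 : (den k : ℝ) * |i * theta + l| = |i * delta k + (i * num k + l * den k : ℤ)| := by
    rw [← h1, abs_mul, abs_of_pos (cast_den_pos k)]
  have h3 : |(i : ℝ)| * delta k = |i * delta k| := by rw [abs_mul, abs_of_pos (delta_pos k)]
  have := abs_sub_abs_le_abs_sub ((i * num k + l * den k : ℤ) : ℝ) (-(i * delta k))
  rwa [abs_neg, sub_neg_eq_add, add_comm _ ((i : ℝ) * delta k), ← h2, ← h3] at this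

theorem one_sub_le_den_mul_abs (k : ℕ) {i l : ℤ} (hi : i ≠ 0) (hik : |i| < den (k + 1)) :
    1 - den (k + 1) * delta (k + 1) ≤ den (k + 1) * |i * theta + l| := by
  refine le_trans ?_ (sub_le_den_mul_abs (k + 1) i l)
  have h1 : (i * num (k + 1) + l * den (k + 1)) ≠ 0 := by
    intro h0
    have h2 : den (k + 1) ∣ i * num (k + 1) := ⟨-l, by linear_combination h0⟩
    exact hi (Int.eq_zero_of_abs_lt_dvd ((isCoprime_num_den k).symm.dvd_of_dvd_mul_right h2) hik)
  have h3 : (1 : ℝ) ≤ |((i * num (k + 1) + l * den (k + 1) : ℤ) : ℝ)| := by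
    exact_mod_cast Int.one_le_abs h1
  have h4 : |(i : ℝ)| ≤ den (k + 1) := by exact_mod_cast hik.le
  nlinarith [delta_pos (k + 1)]

/-- Either the integer nearby vanishes and only `r` remains, or `i * theta + l` is about `1 / den k`
away from 0 and `r` can cancel only part of it. -/
theorem min_le_den_mul_abs (k : ℕ) {i l : ℤ} (hi : |i| ≤ 2 * den k) {r : ℝ} (hr : 0 ≤ r) :
    min (den k * r - 2 * (den k * delta k)) (1 - den k * r - 2 * (den k * delta k)) ≤
      den k * |r + (i * theta + l)| := by
  have hq := cast_den_pos k
  have hi' : |(i : ℝ)| ≤ 2 * den k := by exact_mod_cast hi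
  have hid : |(i : ℝ)| * delta k ≤ 2 * (den k * delta k) := by nlinarith [delta_pos k]
  by_cases h0 : i * num k + l * den k = 0
  · refine (min_le_left _ _).trans ?_
    have h1 : (den k : ℝ) * (i * theta + l) = i * delta k := by
      have h0' : (i * num k + l * den k : ℝ) = 0 := by exact_mod_cast h0
      unfold delta
      linear_combination h0'
    have h2 : (den k : ℝ) * |r + (i * theta + l)| = |den k * r + i * delta k| := by
      rw [← h1, ← mul_add, abs_mul, abs_of_pos hq]
    rw [h2]
    have h3 := neg_abs_le ((i : ℝ) * delta k)
    rw [abs_mul, abs_of_pos (delta_pos k)] at h3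
    linarith [le_abs_self (den k * r + i * delta k)]
  · refine (min_le_right _ _).trans ?_
    have h1 := sub_le_den_mul_abs k i l
    have h2 : (1 : ℝ) ≤ |((i * num k + l * den k : ℤ) : ℝ)| := by
      exact_mod_cast Int.one_le_abs h0
    have h3 : |(i : ℝ) * theta + l| ≤ |r + (i * theta + l)| + r := by
      have := abs_sub (r + (i * theta + l)) r
      rwa [add_sub_cancel_left, abs_of_nonneg hr] at this
    have h4 := mul_le_mul_of_nonneg_left h3 hq.le
    linarith

/-- The coefficients of the expansion of the marked point. -/
noncomputable def coeff (t : ℝ) (k : ℕ) : ℤ := ⌊t * (k + 100)⌋ + 1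

/-- The multiples of the rotation number that approach the marked point from below. -/
noncomputable def mult (t : ℝ) : ℕ → ℤ
  | 0 => 4
  | k + 1 => mult t k + coeff t k * den (k + 1)

/-- The integer parts belonging to `mult`. -/
noncomputable def offset (t : ℝ) : ℕ → ℤ
  | 0 => 1
  | k + 1 => offset t k + coeff t k * num (k + 1)

/-- The approximations of the marked point. -/
noncomputable def approx (t : ℝ) (k : ℕ) : ℝ := mult t k * theta - offset t k

/-- The marked point. -/
noncomputable def point (t : ℝ) : ℝ := ⨆ k, approx t k

/-- The errors of the approximations of the marked point. -/
noncomputable def rho (t : ℝ) (k : ℕ) : ℝ := point t - approx t k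

theorem approx_succ (t : ℝ) (k : ℕ) : approx t (k + 1) = approx t k + coeff t k * delta (k + 1) := by
  simp only [approx, mult, offset, delta]
  push_cast
  ring

theorem lt_coeff (t : ℝ) (k : ℕ) : t * (k + 100) < coeff t k := by
  simp [coeff]

theorem coeff_le (t : ℝ) (k : ℕ) : (coeff t k : ℝ) ≤ t * (k + 100) + 1 := by
  simpa [coeff] using Int.floor_le (t * (k + 100))

variable {t : ℝ}

theorem coeff_pos (ht : 0 ≤ t) (k : ℕ) : (0 : ℝ) < coeff t k :=
  lt_of_le_of_lt (by positivity) (lt_coeff t k)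

/-- By `delta_add_two`, the increment `coeff t k * delta (k + 1)` is `t * (delta k + delta (k + 2))`
plus at most `delta (k + 1)`; the factor 3 leaves room for the rounding errors of all later levels.
-/
theorem point_mem (ht : 0 ≤ t) (ht' : t ≤ 1 / 2) (k : ℕ) :
    point t ∈ Set.Icc (approx t k) (approx t k + (t * delta k + 3 * delta (k + 1))) := by
  have hmono : Monotone (approx t) := by
    refine monotone_nat_of_le_succ fun k => ?_
    rw [approx_succ]
    have := mul_pos (coeff_pos ht k) (delta_pos (k + 1))
    linarith
  have hanti : Antitone fun k => approx t k + (t * delta k + 3 * delta (k + 1)) := by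
    refine antitone_nat_of_succ_le fun k => ?_
    rw [approx_succ]
    have h1 := mul_le_mul_of_nonneg_right (coeff_le t k) (delta_pos (k + 1)).le
    have h2 := delta_add_two k
    have h3 := delta_succ_le (k + 1)
    have h4 := delta_pos (k + 1)
    have h5 := delta_pos (k + 2)
    have h6 : (t * (k + 100) + 1) * delta (k + 1) =
        t * (delta k + delta (k + 2)) + delta (k + 1) := by
      rw [h2]
      ring
    rw [h6] at h1
    nlinarith
  have h := hmono.ciSup_mem_iInter_Icc_of_antitone hanti fun k =>
    le_add_of_nonneg_right (by
      have := delta_pos k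
      have := delta_pos (k + 1)
      positivity)
  exact Set.mem_iInter.1 h k

theorem rho_le (ht : 0 ≤ t) (ht' : t ≤ 1 / 2) (k : ℕ) :
    rho t k ≤ t * delta k + 3 * delta (k + 1) := by
  have := (point_mem ht ht' k).2
  unfold rho
  linarith

theorem lt_rho (ht : 0 ≤ t) (ht' : t ≤ 1 / 2) (k : ℕ) : t * delta k < rho t k := by
  have h1 := (point_mem ht ht' (k + 1)).1
  rw [approx_succ] at h1
  have h2 := mul_lt_mul_of_pos_right (lt_coeff t k) (delta_pos (k + 1))
  have h3 : t * (k + 100) * delta (k + 1) = t * (delta k + delta (k + 2)) := by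
    rw [delta_add_two]
    ring
  have h4 := mul_nonneg ht (delta_pos (k + 2)).le
  unfold rho
  rw [h3] at h2
  linarith

theorem rho_pos (ht : 0 ≤ t) (ht' : t ≤ 1 / 2) (k : ℕ) : 0 < rho t k :=
  lt_of_le_of_lt (mul_nonneg ht (delta_pos k).le) (lt_rho ht ht' k)

theorem one_le_mult (ht : 0 ≤ t) (k : ℕ) : 1 ≤ mult t k := by
  induction k with
  | zero => simp [mult]
  | succ k ih =>
    have h1 : 0 < coeff t k := by exact_mod_cast coeff_pos ht k
    have := mul_pos h1 (den_pos (k + 1))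
    simp only [mult]
    omega

theorem mult_le (ht : 0 ≤ t) (ht' : t ≤ 1 / 2) (k : ℕ) :
    (mult t k : ℝ) ≤ t * den (k + 1) + 7 * den k := by
  induction k with
  | zero =>
    simp only [mult, show den 0 = 5 from rfl, show den (0 + 1) = 7 from rfl]
    push_cast
    linarith
  | succ k ih =>
    have h0 := cast_den_pos (k + 1)
    have h1 := mul_le_mul_of_nonneg_right (coeff_le t k) h0.le
    have h2 : (den (k + 2) : ℝ) = (k + 100) * den (k + 1) - den k := by
      exact_mod_cast den_add_two k
    -- The induction needs `(7 + t) * den k ≤ (6 - t) * den (k + 1)`, and this is the worst case `t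
    -- = 1 / 2`. For `k = 0` it reads 75 ≤ 77.
    have h3 : (15 * den k : ℝ) ≤ 11 * den (k + 1) := by
      cases k with
      | zero => simp [show den 0 = 5 from rfl, show den 1 = 7 from rfl]; norm_num
      | succ k =>
        have h4 : ((k + 99) * den (k + 1) : ℝ) ≤ den (k + 2) := by exact_mod_cast le_den_add_two k
        have h5 := cast_den_pos (k + 1)
        nlinarith [mul_nonneg (Nat.cast_nonneg k : (0 : ℝ) ≤ k) h5.le]
    have h6 : (mult t (k + 1) : ℝ) = mult t k + coeff t k * den (k + 1) := by
      simp only [mult]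
      push_cast
      ring
    have h7 : (t * (k + 100) + 1) * (den (k + 1) : ℝ) = t * (den (k + 2) + den k) + den (k + 1) := by
      rw [h2]
      ring
    rw [h6]
    rw [h7] at h1
    nlinarith [cast_den_pos k]

theorem mult_succ_le_den (ht : 0 ≤ t) (ht' : t ≤ 1 / 2) (k : ℕ) :
    (mult t (k + 1) : ℝ) ≤ den (k + 2) := by
  have h1 := mult_le ht ht' (k + 1)
  have h2 : ((k + 99) * den (k + 1) : ℝ) ≤ den (k + 2) := by exact_mod_cast le_den_add_two k
  have h3 := mul_nonneg (Nat.cast_nonneg k : (0 : ℝ) ≤ k) (cast_den_pos (k + 1)).le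
  have h4 := mul_le_mul_of_nonneg_right ht' (cast_den_pos (k + 2)).le
  linarith [cast_den_pos (k + 1)]

theorem tendsto_den_succ_mul_rho (ht : 0 ≤ t) (ht' : t ≤ 1 / 2) :
    Tendsto (fun k => den (k + 1) * rho t k) atTop (𝓝 t) := by
  have h1 : Tendsto (fun k => t * (den (k + 1) * delta k)) atTop (𝓝 (t * 1)) :=
    tendsto_den_succ_mul_delta.const_mul t
  have h2 : Tendsto (fun k => t * (den (k + 1) * delta k) +
      3 * (den (k + 1) * delta (k + 1))) atTop (𝓝 (t * 1 + 3 * 0)) :=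
    h1.add (((tendsto_add_atTop_iff_nat 1).2 tendsto_den_mul_delta_self).const_mul 3)
  rw [mul_one] at h1
  rw [mul_one, mul_zero, add_zero] at h2
  refine tendsto_of_tendsto_of_tendsto_of_le_of_le h1 h2 (fun k => ?_) fun k => ?_
  · have := mul_le_mul_of_nonneg_left (lt_rho ht ht' k).le (cast_den_pos (k + 1)).le
    simp only
    linarith
  · have := mul_le_mul_of_nonneg_left (rho_le ht ht' k) (cast_den_pos (k + 1)).le
    simp only
    linarith

theorem tendsto_rho (ht : 0 ≤ t) (ht' : t ≤ 1 / 2) : Tendsto (rho t) atTop (𝓝 0) := by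
  have h1 : Tendsto (fun k => t * delta k + 3 * delta (k + 1)) atTop (𝓝 (t * 0 + 3 * 0)) :=
    (tendsto_delta.const_mul t).add (((tendsto_add_atTop_iff_nat 1).2 tendsto_delta).const_mul 3)
  rw [mul_zero, mul_zero, add_zero] at h1
  exact squeeze_zero (fun k => (rho_pos ht ht' k).le) (rho_le ht ht') h1

/-- Otherwise `rho t k` would be a value of `i * theta + l'` with `|i| < den (k + 1)`. If `i ≠ 0`,
it is at least nearly `1 / den (k + 1)`, whereas it is about `t / den (k + 1)`; if `i = 0`, it is an
integer strictly between 0 and 1. -/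
theorem point_ne (ht : 0 ≤ t) (ht' : t ≤ 1 / 2) (j l : ℤ) : point t ≠ j * theta + l := by
  intro heq
  have h1 : ∀ᶠ k in atTop, rho t k < 1 := (tendsto_rho ht ht').eventually_lt_const one_pos
  have h2 : ∀ᶠ k in atTop, den (k + 1) * rho t k < 3 / 4 :=
    (tendsto_den_succ_mul_rho ht ht').eventually_lt_const (by linarith)
  have h3 : ∀ᶠ k in atTop, den (k + 1) * delta (k + 1) < 1 / 4 :=
    ((tendsto_add_atTop_iff_nat 1).2 tendsto_den_mul_delta_self).eventually_lt_const (by norm_num)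
  have h4 : ∀ᶠ k in atTop, |(j : ℝ)| ≤ den k := tendsto_den_atTop.eventually_ge_atTop _
  obtain ⟨k, h1, h2, h3, h4, hk⟩ :=
    (h1.and (h2.and (h3.and (h4.and (eventually_ge_atTop 1))))).exists
  have hρ : rho t k = ((j - mult t k : ℤ) : ℝ) * theta + (l + offset t k : ℤ) := by
    rw [rho, heq, approx]
    push_cast
    ring
  have hpos := rho_pos ht ht' k
  by_cases hi : j - mult t k = 0
  · rw [hi, Int.cast_zero, zero_mul, zero_add] at hρ
    rw [hρ] at h1 hpos
    have h5 : l + offset t k < 1 := by exact_mod_cast h1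
    have h6 : 0 < l + offset t k := by exact_mod_cast hpos
    omega
  · have h5 : |j - mult t k| < den (k + 1) := by
      obtain ⟨k, rfl⟩ := Nat.exists_eq_add_of_le' hk
      have h6 := mult_le ht ht' (k + 1)
      have h7 : ((k + 99) * den (k + 1) : ℝ) ≤ den (k + 2) := by exact_mod_cast le_den_add_two k
      have h8 := cast_den_pos (k + 1)
      have h9 : (1 : ℝ) ≤ mult t (k + 1) := by exact_mod_cast one_le_mult ht (k + 1)
      have h10 := cast_den_pos (k + 2)
      have h11 : |((j - mult t (k + 1) : ℤ) : ℝ)| < den (k + 2) := by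
        rw [abs_le] at h4
        rw [abs_lt]
        push_cast
        have h12 := mul_nonneg (Nat.cast_nonneg k : (0 : ℝ) ≤ k) h8.le
        have h13 : t * den (k + 2) ≤ 1 / 2 * den (k + 2) := by gcongr
        constructor <;> linarith [h4.1, h4.2]
      exact_mod_cast h11
    have h6 := one_sub_le_den_mul_abs k (l := l + offset t k) hi h5
    rw [← hρ, abs_of_pos hpos] at h6
    linarith

/-- The initial values 2/5, 3/7 and `4 * theta - 1` put `theta` near 3/7 and the marked point
between 5/7 and 6/7, which places the exchange in the restricted family. -/
theorem theta_gt : 3 / 7 < theta := by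
  have h := delta_pos 1
  have h1 : delta 1 = 7 * theta - 3 := by
    simp [delta, show den 1 = 7 from rfl, show num 1 = 3 from rfl]
  linarith

theorem theta_lt : theta < 3 / 7 + 1 / 2000 := by
  have h := den_mul_delta_le_two 1
  have h1 : delta 1 = 7 * theta - 3 := by
    simp [delta, show den 1 = 7 from rfl, show num 1 = 3 from rfl]
  rw [show den (1 + 1) = 695 from rfl, h1] at h
  push_cast at h
  linarith

theorem point_gt (ht : 0 ≤ t) (ht' : t ≤ 1 / 2) : 5 / 7 < point t := by
  have h := rho_pos ht ht' 0
  simp only [rho, approx, mult, offset] at h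
  push_cast at h
  linarith [theta_gt]

theorem point_lt (ht : 0 ≤ t) (ht' : t ≤ 1 / 2) : point t < 6 / 7 := by
  have h := rho_le ht ht' 0
  have h1 : delta 1 = 7 * theta - 3 := by
    simp [delta, show den 1 = 7 from rfl, show num 1 = 3 from rfl]
  have h2 : delta 0 = 5 * theta - 2 := by
    simp [delta, show den 0 = 5 from rfl, show num 0 = 2 from rfl]
  simp only [rho, approx, mult, offset, zero_add, h1] at h
  push_cast at h
  have h3 : t * delta 0 ≤ 1 / 2 * delta 0 := by
    have := delta_pos 0
    gcongr
  rw [h2] at h3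
  rw [h2] at h
  linarith [theta_lt]

end Approximation

/-! ### The exchanges realizing every value in [2, +∞] -/

namespace ThreeInterval

open Symbolic Approximation

/-- The first parameter of the exchange induced by the rotation by `theta` on an interval of
length `point t` of the circle of length `1`. -/
noncomputable def paramAlpha (t : ℝ) : ℝ := 1 - theta / point t

/-- The second parameter of the exchange induced by the rotation by `theta` on an interval of
length `point t` of the circle of length `1`. -/
noncomputable def paramBeta (t : ℝ) : ℝ := 1 / point t - 1

variable {t : ℝ}

theorem point_pos (ht : 0 ≤ t) (ht' : t ≤ 1 / 2) : 0 < point t := by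
  linarith [point_gt ht ht']

theorem one_sub_paramAlpha (t : ℝ) : 1 - paramAlpha t = (1 + paramBeta t) * theta := by
  unfold paramAlpha paramBeta
  ring

theorem one_add_paramBeta_mul (ht : 0 ≤ t) (ht' : t ≤ 1 / 2) :
    (1 + paramBeta t) * point t = 1 := by
  have := (point_pos ht ht').ne'
  unfold paramBeta
  field_simp
  ring

theorem one_add_paramBeta_pos (ht : 0 ≤ t) (ht' : t ≤ 1 / 2) : 0 < 1 + paramBeta t := by
  have := point_pos ht ht'
  have h : 1 + paramBeta t = 1 / point t := by unfold paramBeta; ring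
  rw [h]
  positivity

theorem idoc_param (ht : 0 ≤ t) (ht' : t ≤ 1 / 2) : IDOC (paramAlpha t) (paramBeta t) := by
  have hM := (one_add_paramBeta_pos ht ht').ne'
  have h1 := one_sub_paramAlpha t
  have h2 := one_add_paramBeta_mul ht ht'
  intro p q
  have key : ∀ e : ℝ, p * paramAlpha t + q * paramBeta t = p - q + e →
      p * theta - q = -e * point t := by
    intro e he
    refine mul_left_cancel₀ hM ?_
    linear_combination (-(p : ℝ)) * h1 - he + e * h2
  refine ⟨fun he => ?_, fun he => ?_, fun he => ?_⟩
  · have h3 := key 0 (by linarith)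
    have hp : p = 0 := by
      by_contra hp
      refine (irrational_theta.intCast_mul hp).ne_int q ?_
      linarith
    refine ⟨hp, ?_⟩
    rw [hp] at h3
    have : (q : ℝ) = 0 := by push_cast at h3; linarith
    exact_mod_cast this
  · refine point_ne ht ht' (-p) q ?_
    push_cast
    linarith [key 1 he]
  · refine point_ne ht ht' p (-q) ?_
    push_cast
    linarith [key (-1) (by linarith)]

theorem isParameter_param (ht : 0 ≤ t) (ht' : t ≤ 1 / 2) :
    IsParameter (paramAlpha t) (paramBeta t) := by
  have h0 := point_pos ht ht'
  have h1 := point_gt ht ht'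
  have h2 := point_lt ht ht'
  have h3 := theta_gt
  have h4 := theta_lt
  refine ⟨?_, ?_, ?_, idoc_param ht ht'⟩
  · rw [paramAlpha, sub_pos, div_lt_one h0]
    linarith
  · rw [paramBeta, sub_pos, lt_div_iff₀ h0]
    linarith
  · have : paramAlpha t + paramBeta t = (1 - theta) / point t := by
      unfold paramAlpha paramBeta
      ring
    rw [this, div_lt_one h0]
    linarith

theorem paramAlpha_lt_half (ht : 0 ≤ t) (ht' : t ≤ 1 / 2) : paramAlpha t < 1 / 2 := by
  have h0 := point_pos ht ht'
  have : 1 / 2 < theta / point t := by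
    rw [lt_div_iff₀ h0]
    linarith [point_lt ht ht', theta_gt]
  unfold paramAlpha
  linarith

theorem one_lt_two_mul_param (ht : 0 ≤ t) (ht' : t ≤ 1 / 2) :
    1 < 2 * paramAlpha t + paramBeta t := by
  have h0 := point_pos ht ht'
  have h1 : 2 * paramAlpha t + paramBeta t = 1 + (1 - 2 * theta) / point t := by
    unfold paramAlpha paramBeta
    ring
  have h2 : 0 < (1 - 2 * theta) / point t := div_pos (by linarith [theta_lt]) h0
  linarith

variable {μ : Measure (ℕ → Fin 3)}

/-- Two upper bounds for e_n, by `rho t k` and by `delta k`, take over from each other when the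
rotation time passes `mult t k`. -/
theorem eventually_mul_minFreq_le (ht : 0 ≤ t) (ht' : t ≤ 1 / 2)
    (hμ : IsInvariantProbability (language (paramAlpha t) (paramBeta t)) μ) {c : ℝ} (hc : t < c) :
    ∀ᶠ n : ℕ in atTop,
      (n : ℝ≥0∞) * minFreq (language (paramAlpha t) (paramBeta t)) μ n ≤ ENNReal.ofReal c := by
  have hM := one_add_paramBeta_pos ht ht'
  have hc0 : 0 < c := ht.trans_lt hc
  have hθ := one_sub_paramAlpha t
  have hMy := one_add_paramBeta_mul ht ht'
  set M := 1 + paramBeta t with hMdef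
  obtain ⟨ε, hε, hεM, hεc⟩ : ∃ ε, 0 < ε ∧ ε < M ∧ t * M < c * (M - ε) := by
    refine ⟨M * ((c - t) / (2 * c)), ?_, ?_, ?_⟩
    · have : 0 < c - t := by linarith
      positivity
    · refine mul_lt_of_lt_one_right hM ?_
      rw [div_lt_one (by positivity)]
      linarith
    · have : c * (M - M * ((c - t) / (2 * c))) = M * ((c + t) / 2) := by field_simp; ring
      rw [this]
      nlinarith
  set κ := M - ε
  have hκ : 0 < κ := by simp only [κ]; linarith
  obtain ⟨C, hC, hbound⟩ := exists_minFreq_le (isParameter_param ht ht') hμ hε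
  have hlim : ∀ u : ℕ → ℝ, Tendsto u atTop (𝓝 t) → ∀ v : ℕ → ℝ, Tendsto v atTop (𝓝 0) →
      ∀ᶠ k in atTop, (u k + C * v k) * M / κ < c := by
    intro u hu v hv
    have h1 : Tendsto (fun k => (u k + C * v k) * M / κ) atTop (𝓝 ((t + C * 0) * M / κ)) :=
      ((hu.add (hv.const_mul C)).mul_const M).div_const κ
    refine h1.eventually_lt_const ?_
    rw [mul_zero, add_zero, div_lt_iff₀ hκ]
    exact hεc
  have hu2 : Tendsto (fun k => t * (den (k + 1) * delta k) + 7 * (den k * delta k)) atTop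
      (𝓝 t) := by
    have := (tendsto_den_succ_mul_delta.const_mul t).add (tendsto_den_mul_delta_self.const_mul 7)
    simpa using this
  have hsmall : ∀ v : ℕ → ℝ, Tendsto v atTop (𝓝 0) → ∀ᶠ k in atTop, M * v k < 1 := by
    intro v hv
    have h1 := hv.const_mul M
    rw [mul_zero] at h1
    exact h1.eventually_lt_const one_pos
  obtain ⟨K, hK⟩ := eventually_atTop.1
    ((hlim _ (tendsto_den_succ_mul_rho ht ht') _ (tendsto_rho ht ht')).and
      ((hlim _ hu2 _ tendsto_delta).and
        ((hsmall _ (tendsto_rho ht ht')).and (hsmall _ tendsto_delta))))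
  have hex : ∀ n : ℕ, ∃ k, (n : ℝ) * κ < den k + C := fun n =>
    ((tendsto_atTop_add_const_right _ C tendsto_den_atTop).eventually_gt_atTop _).exists
  obtain ⟨N, hN⟩ := exists_nat_gt ((den K + C) / κ)
  rw [div_lt_iff₀ hκ] at hN
  filter_upwards [eventually_ge_atTop N] with n hn
  -- The level `k` is the one for which the guaranteed rotation time `n * κ - C` lies between
  -- consecutive denominators.
  obtain ⟨k, hKk, hk1, hk2⟩ :
      ∃ k, K ≤ k ∧ (den k + C : ℝ) ≤ n * κ ∧ (n : ℝ) * κ < den (k + 1) + C := by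
    have hn' : (N : ℝ) * κ ≤ n * κ := by gcongr
    have hfind := Nat.find_spec (hex n)
    have hKlt : K < Nat.find (hex n) := by
      by_contra! hle
      have : (den (Nat.find (hex n)) : ℝ) ≤ den K := by
        exact_mod_cast strictMono_den.monotone hle
      linarith
    obtain ⟨k, hk⟩ := Nat.exists_eq_succ_of_ne_zero (Nat.ne_zero_of_lt hKlt)
    rw [hk] at hfind hKlt
    exact ⟨k, by omega, not_lt.1 (Nat.find_min (hex n) (m := k) (by omega)), hfind⟩
  obtain ⟨hρ, hδ, hρ1, hδ1⟩ := hK k hKk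
  have hδ0 := delta_pos k
  have hρ0 := rho_pos ht ht' k
  have hfin : ∀ d : ℝ, minFreq (language (paramAlpha t) (paramBeta t)) μ n ≤ ENNReal.ofReal d →
      n * d ≤ c →
      (n : ℝ≥0∞) * minFreq (language (paramAlpha t) (paramBeta t)) μ n ≤ ENNReal.ofReal c := by
    intro d h1 h2
    calc (n : ℝ≥0∞) * minFreq (language (paramAlpha t) (paramBeta t)) μ n
        ≤ n * ENNReal.ofReal d := by gcongr
      _ = ENNReal.ofReal (n * d) := by
        rw [ENNReal.ofReal_mul (by positivity), ENNReal.ofReal_natCast]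
      _ ≤ ENNReal.ofReal c := ENNReal.ofReal_le_ofReal h2
  have hto : ∀ {z : ℤ}, 1 ≤ z → ((z.toNat : ℕ) : ℝ) = z := by
    intro z hz
    rw [← Int.cast_natCast, Int.toNat_of_nonneg (by omega)]
  -- If there is time for `mult t k` steps, use `rho t k` and `n * κ < den (k + 1) + C`. Otherwise
  -- use `delta k` and `n * κ < mult t k + C`. Both products tend to `t * M / κ` at most, which is
  -- below `c` by the choice of `ε`.
  rcases le_or_gt (mult t k + C) (n * κ) with hcase | hcase
  · refine hfin (M * rho t k) (hbound n (mult t k).toNat (offset t k) _ (by positivity) hρ1 ?_ ?_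
      (Or.inl ?_)) ?_
    · have := one_le_mult ht k
      omega
    · rw [hto (one_le_mult ht k)]
      linarith
    · rw [hto (one_le_mult ht k), hθ, rho, approx]
      linear_combination hMy
    · refine le_trans ?_ hρ.le
      rw [le_div_iff₀ hκ]
      have := mul_le_mul_of_nonneg_right hk2.le (by positivity : 0 ≤ M * rho t k)
      linarith
  · refine hfin (M * delta k) (hbound n (den k).toNat (num k) _ (by positivity) hδ1 ?_ ?_
      (Or.inr ?_)) ?_
    · have := den_pos k
      omega
    · rw [hto (den_pos k)]
      linarith
    · rw [hto (den_pos k), hθ, delta]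
      ring
    · refine le_trans ?_ hδ.le
      rw [le_div_iff₀ hκ]
      have h1 := mul_le_mul_of_nonneg_right hcase.le (by positivity : 0 ≤ M * delta k)
      have h2 := mul_le_mul_of_nonneg_right (mult_le ht ht' k) (by positivity : 0 ≤ M * delta k)
      linarith

theorem frequently_le_mul_minFreq (ht : 0 ≤ t) (ht' : t ≤ 1 / 2)
    (hμ : IsInvariantProbability (language (paramAlpha t) (paramBeta t)) μ) {c : ℝ} (hc0 : 0 ≤ c)
    (hc : c < t) :
    ∃ᶠ n : ℕ in atTop,
      ENNReal.ofReal c ≤ (n : ℝ≥0∞) * minFreq (language (paramAlpha t) (paramBeta t)) μ n := by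
  have hM := one_add_paramBeta_pos ht ht'
  have ht0 : 0 < t := hc0.trans_lt hc
  have hθ := one_sub_paramAlpha t
  have hMy := one_add_paramBeta_mul ht ht'
  set M := 1 + paramBeta t with hMdef
  obtain ⟨ε, hε, hεc⟩ : ∃ ε, 0 < ε ∧ c * (M + ε) < t * M := by
    refine ⟨M * ((t - c) / (2 * t)), ?_, ?_⟩
    · have : 0 < t - c := by linarith
      positivity
    · have h1 : t * (M * ((t - c) / (2 * t))) = M * ((t - c) / 2) := by field_simp
      have h2 : 0 < M * ((t - c) / (2 * t)) := by
        have : 0 < t - c := by linarith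
        positivity
      nlinarith
  set κ := M + ε with hκdef
  have hκ : 0 < κ := by linarith
  obtain ⟨C, hC, hbound⟩ := exists_le_minFreq (isParameter_param ht ht') hμ hε
  let q : ℕ → ℝ := fun k => den (k + 1)
  let η : ℕ → ℝ := fun k => den (k + 1) * delta (k + 1)
  let r : ℕ → ℝ := fun k => den (k + 1) * rho t k
  let s : ℕ → ℝ := fun k => min (1 - η k) (min (r k - 2 * η k) (1 - r k - 2 * η k))
  have hq : Tendsto q atTop atTop :=
    (tendsto_add_atTop_iff_nat (f := fun k => (den k : ℝ)) 1).2 tendsto_den_atTop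
  have hη : Tendsto η atTop (𝓝 0) :=
    (tendsto_add_atTop_iff_nat (f := fun k => den k * delta k) 1).2 tendsto_den_mul_delta_self
  have hr : Tendsto r atTop (𝓝 t) := tendsto_den_succ_mul_rho ht ht'
  have hs : Tendsto s atTop (𝓝 t) := by
    have h1 : Tendsto s atTop (𝓝 (min (1 - 0) (min (t - 2 * 0) (1 - t - 2 * 0)))) :=
      (hη.const_sub 1).min ((hr.sub (hη.const_mul 2)).min ((hr.const_sub 1).sub (hη.const_mul 2)))
    -- The minimum is `t`, and not `1 - t`, because `t ≤ 1 / 2`.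
    have h2 : min (1 - 0) (min (t - 2 * 0) (1 - t - 2 * 0)) = t := by
      rw [min_eq_left (a := t - 2 * 0) (by linarith), min_eq_right (by linarith)]
      ring
    rwa [h2] at h1
  -- The largest length for which the rotation times in `exists_le_minFreq` are bounded by `den (k +
  -- 1) - 1`, just before the next close return.
  let n : ℕ → ℕ := fun k => ⌊(q k - 1 - C) / κ⌋₊
  have hqC : Tendsto (fun k => (q k - 1 - C) / κ) atTop atTop := by
    simp only [sub_eq_add_neg]
    exact (tendsto_atTop_add_const_right _ _ (tendsto_atTop_add_const_right _ _ hq)).atTop_div_const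
      hκ
  have hn : Tendsto n atTop atTop := tendsto_nat_floor_atTop.comp hqC
  refine hn.frequently (Eventually.frequently ?_)
  have hev1 : ∀ᶠ k in atTop, 0 ≤ (q k - 1 - C) / κ := hqC.eventually_ge_atTop 0
  have hlim : Tendsto (fun k => ((1 - (1 + C) * (q k)⁻¹) / κ - (q k)⁻¹) * (M * s k)) atTop
      (𝓝 (((1 - (1 + C) * 0) / κ - 0) * (M * t))) := by
    have hinv : Tendsto (fun k => (q k)⁻¹) atTop (𝓝 0) := tendsto_inv_atTop_zero.comp hq
    exact ((((hinv.const_mul (1 + C)).const_sub 1).div_const κ).sub hinv).mul (hs.const_mul M)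
  have hev2 : ∀ᶠ k in atTop, c < ((1 - (1 + C) * (q k)⁻¹) / κ - (q k)⁻¹) * (M * s k) := by
    refine hlim.eventually_const_lt ?_
    rw [mul_zero, sub_zero, sub_zero, one_div, inv_mul_eq_div, lt_div_iff₀ hκ]
    linarith
  have hev3 : ∀ᶠ k in atTop, 0 < s k := hs.eventually_const_lt ht0
  filter_upwards [hev1, hev2, hev3, hq.eventually_ge_atTop M, eventually_ge_atTop 1]
    with k h1 h2 h3 h4 hk
  have hq0 : 0 < q k := cast_den_pos (k + 1)
  have hs1 : s k ≤ 1 := by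
    refine (min_le_left _ _).trans ?_
    have : 0 < η k := mul_pos (cast_den_pos _) (delta_pos _)
    linarith
  have hnk : (n k : ℝ) ≤ (q k - 1 - C) / κ := Nat.floor_le h1
  have hnk' : (q k - 1 - C) / κ - 1 ≤ n k := (Nat.sub_one_lt_floor _).le
  have hj : ∀ j : ℤ, |(j : ℝ)| ≤ κ * n k + C → |j| < den (k + 1) := by
    intro j hj
    rw [le_div_iff₀ hκ] at hnk
    have : |(j : ℝ)| < den (k + 1) := by
      have : q k = den (k + 1) := rfl
      linarith
    exact_mod_cast this
  have hmain := hbound (n k) (M * s k / q k) ?_ ?_ ?_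
  · calc ENNReal.ofReal c ≤ ENNReal.ofReal (n k * (M * s k / q k)) := by
          refine ENNReal.ofReal_le_ofReal (h2.le.trans ?_)
          have h5 : ((1 - (1 + C) * (q k)⁻¹) / κ - (q k)⁻¹) * (M * s k) =
              ((q k - 1 - C) / κ - 1) * (M * s k / q k) := by
            field_simp
            ring
          rw [h5]
          gcongr
      _ = n k * ENNReal.ofReal (M * s k / q k) := by
          rw [ENNReal.ofReal_mul (by positivity), ENNReal.ofReal_natCast]
      _ ≤ n k * minFreq (language (paramAlpha t) (paramBeta t)) μ (n k) := by gcongr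
  · rw [div_le_one hq0]
    nlinarith
  · intro j l hjn hj0
    have h5 := one_sub_le_den_mul_abs k (l := l) hj0 (hj j hjn)
    have h6 : |(j : ℝ) * (1 - paramAlpha t) + l * M| = M * |j * theta + l| := by
      rw [hθ, ← abs_of_pos hM, ← abs_mul, abs_of_pos hM]
      congr 1
      ring
    rw [h6, div_le_iff₀ hq0, mul_assoc]
    refine mul_le_mul_of_nonneg_left ((min_le_left _ _).trans ?_) hM.le
    rw [mul_comm _ (q k)]
    exact h5
  · intro j l hjn
    have hmk : |mult t k + j| ≤ 2 * den (k + 1) := by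
      obtain ⟨k, rfl⟩ := Nat.exists_eq_add_of_le' hk
      have h5 : mult t (k + 1) ≤ den (k + 1 + 1) := by exact_mod_cast mult_succ_le_den ht ht' k
      have h6 := one_le_mult ht (k + 1)
      have h7 := hj j hjn
      rw [abs_lt] at h7
      rw [abs_le]
      constructor <;> omega
    have h5 := min_le_den_mul_abs (k + 1) (l := l - offset t k) hmk (rho_pos ht ht' k).le
    have h6 : |1 + (j : ℝ) * (1 - paramAlpha t) + l * M| =
        M * |rho t k + (((mult t k + j : ℤ) : ℝ) * theta + (l - offset t k : ℤ))| := by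
      rw [hθ, ← abs_of_pos hM, ← abs_mul, abs_of_pos hM]
      congr 1
      rw [rho, approx]
      push_cast
      linear_combination -hMy
    rw [h6, div_le_iff₀ hq0, mul_assoc]
    refine mul_le_mul_of_nonneg_left ((min_le_right _ _).trans ?_) hM.le
    rw [mul_comm _ (q k)]
    exact h5

theorem limsup_mul_minFreq (ht : 0 ≤ t) (ht' : t ≤ 1 / 2)
    (hμ : IsInvariantProbability (language (paramAlpha t) (paramBeta t)) μ) :
    limsup (fun n : ℕ => (n : ℝ≥0∞) * minFreq (language (paramAlpha t) (paramBeta t)) μ n) atTop =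
      ENNReal.ofReal t := by
  apply le_antisymm
  · refine ENNReal.le_of_forall_pos_le_add fun ε hε _ => ?_
    rw [← ENNReal.ofReal_coe_nnreal, ← ENNReal.ofReal_add ht ε.coe_nonneg]
    exact limsup_le_of_le (by isBoundedDefault)
      (eventually_mul_minFreq_le ht ht' hμ (lt_add_of_pos_right t (by exact_mod_cast hε)))
  · by_contra! hlt
    obtain ⟨b, hb1, hb2⟩ := exists_between hlt
    have hb : b ≠ ∞ := (hb2.trans ENNReal.ofReal_lt_top).ne
    rw [← ENNReal.ofReal_toReal hb] at hb1 hb2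
    have hbt := (ENNReal.ofReal_lt_ofReal_iff_of_nonneg ENNReal.toReal_nonneg).1 hb2
    have := le_limsup_of_frequently_le
      (frequently_le_mul_minFreq ht ht' hμ ENNReal.toReal_nonneg hbt)
    exact absurd hb1 this.not_gt

theorem lowerB_param (ht : 0 ≤ t) (ht' : t ≤ 1 / 2)
    (hμ : IsInvariantProbability (language (paramAlpha t) (paramBeta t)) μ) :
    lowerB (language (paramAlpha t) (paramBeta t)) μ = (ENNReal.ofReal t)⁻¹ := by
  rw [← limsup_mul_minFreq ht ht' hμ, ENNReal.inv_limsup, lowerB]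
  simp only [one_div]

theorem restrictedFamily_subset : restrictedFamily ⊆ family := by
  rintro L ⟨α, β, h, -, -, rfl⟩
  exact ⟨α, β, h, rfl⟩

theorem language_param_mem (ht : 0 ≤ t) (ht' : t ≤ 1 / 2) :
    language (paramAlpha t) (paramBeta t) ∈ restrictedFamily :=
  ⟨_, _, isParameter_param ht ht', paramAlpha_lt_half ht ht', one_lt_two_mul_param ht ht', rfl⟩

theorem lowerBLSpectrum_family_subset : lowerBLSpectrum family ⊆ Set.Icc 2 ⊤ := by
  rintro v ⟨L, ⟨α, β, h, rfl⟩, μ, hμ, rfl⟩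
  exact ⟨two_le_lowerB h hμ.1, le_top⟩

theorem subset_lowerBLSpectrum_restrictedFamily :
    Set.Icc 2 ⊤ ⊆ lowerBLSpectrum restrictedFamily := by
  rintro v ⟨hv, -⟩
  have hv0 : v⁻¹ ≠ ∞ := ENNReal.inv_ne_top.2 (two_pos.trans_le hv).ne'
  have ht : v⁻¹.toReal ≤ 1 / 2 := by
    have := ENNReal.toReal_mono (by simp) (ENNReal.inv_le_inv.2 hv)
    simpa using this
  have ht0 : 0 ≤ v⁻¹.toReal := ENNReal.toReal_nonneg
  have hμ := isUniqueInvariantProbability_trajectoryMeasure (isParameter_param ht0 ht)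
  refine ⟨_, language_param_mem ht0 ht, _, hμ, ?_⟩
  rw [lowerB_param ht0 ht hμ.1, ENNReal.ofReal_toReal hv0, inv_inv]

theorem lowerBLSpectrum_mono {F G : Set (Language (Fin 3))} (h : F ⊆ G) :
    lowerBLSpectrum F ⊆ lowerBLSpectrum G := by
  rintro v ⟨L, hL, hv⟩
  exact ⟨L, h hL, hv⟩

end ThreeInterval

theorem mainTheorem6 :
    (∀ L ∈ ThreeInterval.family, Symbolic.IsMinimal L ∧ Symbolic.IsUniquelyErgodic L) ∧
    Symbolic.lowerBLSpectrum ThreeInterval.family = Set.Icc (2 : ℝ≥0∞) ⊤ ∧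
    Symbolic.lowerBLSpectrum ThreeInterval.restrictedFamily = Set.Icc (2 : ℝ≥0∞) ⊤ ∧
    (∃ L ∈ ThreeInterval.family, Symbolic.IsMinimal L ∧
      ∃ μ : Measure (ℕ → Fin 3), Symbolic.IsUniqueInvariantProbability L μ ∧
        Tendsto (fun n : ℕ => (n : ℝ≥0∞) * Symbolic.minFreq L μ n) atTop (𝓝 0)) := by
  open ThreeInterval in
  have hmono := lowerBLSpectrum_mono restrictedFamily_subset
  have hsub := lowerBLSpectrum_family_subset
  have hsup := subset_lowerBLSpectrum_restrictedFamily
  refine ⟨?_, hsub.antisymm (hsup.trans hmono), (hmono.trans hsub).antisymm hsup, ?_⟩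
  · rintro L ⟨α, β, h, rfl⟩
    exact ⟨isMinimal_language h, _, isUniqueInvariantProbability_trajectoryMeasure h⟩
  · have ht : (0 : ℝ) ≤ 1 / 2 := by norm_num
    -- This is `t = 0`, for which the limsup of `n * minFreq` is 0.
    have h := isParameter_param le_rfl ht
    have hμ := isUniqueInvariantProbability_trajectoryMeasure h
    refine ⟨_, ⟨_, _, h, rfl⟩, isMinimal_language h, _, hμ, ?_⟩
    refine tendsto_of_le_liminf_of_limsup_le zero_le ?_
    rw [limsup_mul_minFreq le_rfl ht hμ.1, ENNReal.ofReal_zero]
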